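/- Let $\gamma:[-1,1]\to\mathbb R$ be smooth with $\gamma(t)-t\gamma'(t)\neq 0$ for $-1<t<1$, put $\mu_2(t):=1/(\gamma(t)-t\gamma'(t))$, and consider the axially symmetric anisotropic energy $\mathcal F=\int_\Sigma\gamma(\nu_3)\,d\Sigma$ of oriented surfaces in $\mathbb R^3$ with unit normal $\nu$. The anisotropic mean curvature $\Lambda$ of a surface is defined by the first variation formula $\delta\mathcal F=-\int_\Sigma\Lambda\,\dot X\cdot\nu\,d\Sigma$ for all smooth compactly supported variations $\dot X$. Let $J\subset\mathbb R$ be an open interval, $(x,y):J\to\mathbb R^2$ a smooth curve parametrized by arc length, $\omega,C\in\mathbb R$, and let $X$ be the helicoidal surface $$X(s,\vartheta)=\big((x(s)+iy(s))e^{-i\omega\vartheta},\ \vartheta+C\big),\qquad (s,\vartheta)\in J\times\mathbb R,$$ in $\mathbb R^3=\mathbb C\times\mathbb R$, oriented by $\nu=X_s\times X_\vartheta/|X_s\times X_\vartheta|$. Let $\eta_1=-\tfrac12(x^2+y^2)'$ and $\eta_2=xy'-yx'$ be the components of the treadmill sled of $(x,y)$. For real $\Lambda$, $A$ consider the equation $$(H)\qquad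 \Lambda(\eta_1^2+\eta_2^2)+\frac{2\eta_2}{\mu_2\!\left(\frac{\omega\eta_1}{\sqrt{1+\omega^2\eta_1^2}}\right)\sqrt{1+\omega^2\eta_1^2}}+A\equiv 0\quad\text{on } J.$$ 1. If $X$ has constant anisotropic mean curvature $\Lambda$, then (H) holds with this $\Lambda$ for some real constant $A$. 2. $X$ has constant anisotropic mean curvature if and only if (H) holds for some real constants $\Lambda$, $A$. 3. If $x^2+y^2$ is not constant on $J$ (that is, $X$ does not lie on a circular cylinder about the $x_3$-axis), then for every real $\Lambda$: $X$ has constant anisotropic mean curvature $\Lambda$ if and only if (H) holds with this $\Lambda$ for some real constant $A$. 4. If $x^2+y^2$ is constant on $J$, then for every real $\Lambda$: $X$ has constant anisotropic mean curvature $\Lambda$ if and only if $\Lambda=-1/(\eta_2\,\mu_2(0))$ on $J$. 5. The generating curve is recovered from its treadmill sled by a quadrature: if $s_0,s\in J$ and $\eta_1$ has no zero between $s_0$ and $s$ (both included), then $$x(s)+iy(s)=-\big(\eta_1(s)+i\eta_2(s)\big)\,\big(x'(s_0)+iy'(s_0)\big)\exp\Big(-i\int_{s_0}^{s}\frac{\eta_2'(t)}{\eta_1(t)}\,dt\Big).$$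 -/

import Mathlib

/-- The cross product of two vectors of Euclidean 3-space. -/
noncomputable def cross3 (u v : EuclideanSpace ℝ (Fin 3)) : EuclideanSpace ℝ (Fin 3) :=
  WithLp.toLp 2 (crossProduct (WithLp.ofLp u) (WithLp.ofLp v))

/-- The normal vector `X_s × X_ϑ` of a parametrized surface `X(s, ϑ)`; its length is the density of
the area element `dΣ` with respect to `ds dϑ`. -/
noncomputable def surfaceNormal (X : ℝ × ℝ → EuclideanSpace ℝ (Fin 3)) (p : ℝ × ℝ) :
    EuclideanSpace ℝ (Fin 3) :=
  cross3 (fderiv ℝ X p (1, 0)) (fderiv ℝ X p (0, 1))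

/-- The Gauss map `ν` of a parametrized surface, for the orientation given by `(s, ϑ)`. -/
noncomputable def gaussMap (X : ℝ × ℝ → EuclideanSpace ℝ (Fin 3)) (p : ℝ × ℝ) :
    EuclideanSpace ℝ (Fin 3) :=
  ‖surfaceNormal X p‖⁻¹ • surfaceNormal X p

/-- The anisotropic energy `∫ Γ(ν) dΣ` of the part of the surface `X` parametrized by `K`, for a
density `Γ` (only its values on the unit sphere matter). -/
noncomputable def anisotropicEnergy (Γ : EuclideanSpace ℝ (Fin 3) → ℝ)
    (X : ℝ × ℝ → EuclideanSpace ℝ (Fin 3)) (K : Set (ℝ × ℝ)) : ℝ :=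
  ∫ p in K, Γ (gaussMap X p) * ‖surfaceNormal X p‖

/-- `Λ` is the anisotropic mean curvature of the surface `X : U → ℝ³` for the density `Γ`: the first
variation formula `δF = - ∫ Λ ⟨V, ν⟩ dΣ` holds for the variations `X + ε V` with an arbitrary smooth
variation field `V` of compact support in `U` (so that there are no boundary terms). -/
def HasAnisotropicMeanCurvature (Γ : EuclideanSpace ℝ (Fin 3) → ℝ) (U : Set (ℝ × ℝ))
    (X : ℝ × ℝ → EuclideanSpace ℝ (Fin 3)) (Λ : ℝ × ℝ → ℝ) : Prop :=
  ∀ V : ℝ × ℝ → EuclideanSpace ℝ (Fin 3),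
    ContDiff ℝ (⊤ : ℕ∞) V → HasCompactSupport V → tsupport V ⊆ U →
      HasDerivAt (fun ε : ℝ => anisotropicEnergy Γ (fun p => X p + ε • V p) (tsupport V))
        (-∫ p in tsupport V, Λ p * inner ℝ (V p) (gaussMap X p) * ‖surfaceNormal X p‖) 0

/-- The helicoidal surface `X(s, ϑ) = ((x(s) + i y(s)) e^{-iωϑ}, ϑ + C)`, with `ℝ³ = ℂ × ℝ`. -/
noncomputable def helicoidalSurface (x y : ℝ → ℝ) (ω C : ℝ) (p : ℝ × ℝ) :
    EuclideanSpace ℝ (Fin 3) :=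
  !₂[x p.1 * Real.cos (ω * p.2) + y p.1 * Real.sin (ω * p.2),
    y p.1 * Real.cos (ω * p.2) - x p.1 * Real.sin (ω * p.2),
    p.2 + C]

/-- First coordinate `η₁ = -½ (x² + y²)'` of the treadmill sled of the plane curve `(x, y)`. -/
noncomputable def treadmill₁ (x y : ℝ → ℝ) (s : ℝ) : ℝ :=
  -1 / 2 * deriv (fun t => x t ^ 2 + y t ^ 2) s

/-- Second coordinate `η₂ = x y' - y x'` of the treadmill sled of the plane curve `(x, y)`. -/
noncomputable def treadmill₂ (x y : ℝ → ℝ) (s : ℝ) : ℝ :=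
  x s * deriv y s - y s * deriv x s

/-- The principal curvature `μ₂` of the Wulff shape, `1 / μ₂ = γ(ν₃) - ν₃ γ'(ν₃)`. -/
noncomputable def wulffMu₂ (γ : ℝ → ℝ) (t : ℝ) : ℝ :=
  1 / (γ t - t * deriv γ t)

/-- The helicoidal surface over the parameter domain `J × ℝ` has constant anisotropic mean curvature
`Λ` for the axially symmetric density `ν ↦ γ(ν₃)`. -/
def HelicoidalHasConstantAMC (γ : ℝ → ℝ) (J : Set ℝ) (x y : ℝ → ℝ) (ω C Λ : ℝ) : Prop :=
  HasAnisotropicMeanCurvature (fun ν => γ (ν 2)) (J ×ˢ Set.univ) (helicoidalSurface x y ω C)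
    (fun _ => Λ)

/-- The equation
`Λ (η₁² + η₂²) + 2 η₂ / (μ₂(ω η₁ / √(1 + ω² η₁²)) √(1 + ω² η₁²)) + A = 0` along the curve. -/
def TwizzlerEquation (γ : ℝ → ℝ) (J : Set ℝ) (x y : ℝ → ℝ) (ω Λ A : ℝ) : Prop :=
  ∀ s ∈ J,
    Λ * (treadmill₁ x y s ^ 2 + treadmill₂ x y s ^ 2) +
      2 * treadmill₂ x y s /
        (wulffMu₂ γ (ω * treadmill₁ x y s / Real.sqrt (1 + ω ^ 2 * treadmill₁ x y s ^ 2)) *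
          Real.sqrt (1 + ω ^ 2 * treadmill₁ x y s ^ 2)) + A = 0

/-! Extended to be positively homogeneous of degree one, the density becomes a function `G` of the
unnormalised normal `N = X_s × X_ϑ`, and the energy is `∫ G(N) ds dϑ`. Differentiating in `ε` and
integrating by parts gives the Euler-Lagrange expression `∂_s (X_ϑ × ξ) + ∂_ϑ (ξ × X_s)` with `ξ =
∇G(N)`. If it equals `Λ N`, then `Λ` is the anisotropic mean curvature
(`hasAnisotropicMeanCurvature_of_divergence`), and no other continuous function is
(`HasAnisotropicMeanCurvature.eqOn`).

On a helicoidal surface `N` is never vertical, so only `γ` on the open interval matters, and `ξ = P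
N + γ'(ν₃) e₃`, where `P = 1 / (μ₂ √(1 + ω² η₁²))`. Let `Q` be the vertical component of `ξ` and `κ`
the curvature of the generating curve. The structural identity `P' = -ω Q' η₁`
(`deriv_cahnHoffmanHorizontal`) makes the divergence a multiple of `N`, with factor `H = -(P κ + ω
Q' η₂)` (`divergence_helicoidalCahnHoffman`).

Equation (H) is a first integral: with the treadmill equations `η₁' = -1 + κ η₂` and `η₂' = -κ η₁`,
its left side has derivative `-2 η₁ (Λ - H)` (`hasDerivAt_twizzler`). So constant curvature `Λ`
implies (H). The converse needs the factor `η₁` cancelled, although `η₁` may vanish on subarcs: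
there the curve is an arc of a circle about the origin and `H` is locally constant, which is enough
by connectedness unless `η₁` vanishes identically (`helicoidalAMC_eq_of_mul_eq_zero`). In that
exceptional case the surface is cylindrical, (H) does not determine `Λ`, and `H` is constant anyway.

For the quadrature, let `T = x' + i y'`. Then `(x + i y) T̄ = -(η₁ + i η₂)`, `|T| = 1`, `T' = i κ
T`, and `κ = -η₂' / η₁`. -/

open MeasureTheory Topology

/-! ### Analytic tools: parameter integrals, integration by parts, the fundamental lemma. -/

/-- Differentiation under the integral sign over a compact parameter set, for an integrand which is
jointly `C¹` near the compact set. -/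
theorem hasDerivAt_setIntegral_of_isCompact {α : Type*} [TopologicalSpace α] [T2Space α]
    [MeasurableSpace α] [OpensMeasurableSpace α] {μ : Measure α}
    [IsFiniteMeasureOnCompacts μ] {K : Set α} (hK : IsCompact K) {W : Set (α × ℝ)} (hW : IsOpen W)
    {a : ℝ} (hKW : K ×ˢ {a} ⊆ W) {F F' : α × ℝ → ℝ}
    (hF : ContinuousOn F (W ∩ K ×ˢ Set.univ)) (hF' : ContinuousOn F' (W ∩ K ×ˢ Set.univ))
    (hd : ∀ p ∈ K, ∀ ε : ℝ, (p, ε) ∈ W → HasDerivAt (fun e => F (p, e)) (F' (p, ε)) ε) :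
    HasDerivAt (fun ε => ∫ p in K, F (p, ε) ∂μ) (∫ p in K, F' (p, a) ∂μ) a := by
  -- The tube lemma turns `W` into a product neighbourhood, hence an interval of parameters valid
  -- for all points of `K` at once; compactness then bounds `F'` by a constant, which serves as
  -- dominating function.
  obtain ⟨u, v, -, hv, hKu, hav, huv⟩ := generalized_tube_lemma hK isCompact_singleton hW hKW
  obtain ⟨δ, hδ, hball⟩ := Metric.isOpen_iff.1 hv a (hav rfl)
  have hsub : ∀ ε ∈ Metric.closedBall a (δ / 2), ε ∈ v := fun ε hε =>
    hball (Metric.closedBall_subset_ball (by linarith) hε)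
  have hprod : K ×ˢ Metric.closedBall a (δ / 2) ⊆ W ∩ K ×ˢ Set.univ := fun q hq =>
    ⟨huv ⟨hKu hq.1, hsub _ hq.2⟩, hq.1, trivial⟩
  have hslice : ∀ {H : α × ℝ → ℝ}, ContinuousOn H (W ∩ K ×ˢ Set.univ) →
      ∀ ε ∈ Metric.closedBall a (δ / 2), ContinuousOn (fun p => H (p, ε)) K := fun hH ε hε =>
    hH.comp (by fun_prop) fun p hp => hprod ⟨hp, hε⟩
  have ha : a ∈ Metric.closedBall a (δ / 2) := Metric.mem_closedBall_self (by linarith)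
  obtain ⟨M, hM⟩ := (hK.prod (isCompact_closedBall a (δ / 2))).exists_bound_of_continuousOn
    (hF'.mono hprod)
  have hnhds : Metric.closedBall a (δ / 2) ∈ 𝓝 a := Metric.closedBall_mem_nhds a (by linarith)
  have hfin : IsFiniteMeasure (μ.restrict K) := ⟨by simpa using hK.measure_lt_top⟩
  refine (hasDerivAt_integral_of_dominated_loc_of_deriv_le (bound := fun _ => M)
    (F := fun ε p => F (p, ε)) (F' := fun ε p => F' (p, ε)) hnhds ?_ ?_ ?_ ?_
    (integrable_const M) ?_).2
  · filter_upwards [hnhds] with ε hε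
    exact (hslice hF ε hε).aestronglyMeasurable_of_isCompact hK hK.measurableSet
  · exact (hslice hF a ha).integrableOn_compact hK
  · exact (hslice hF' a ha).aestronglyMeasurable_of_isCompact hK hK.measurableSet
  · exact (ae_restrict_iff' hK.measurableSet).2 (.of_forall fun p hp ε hε => hM (p, ε) ⟨hp, hε⟩)
  · exact (ae_restrict_iff' hK.measurableSet).2
      (.of_forall fun p hp ε hε => hd p hp ε (hprod ⟨hp, hε⟩).1)

theorem integrable_of_continuousOn_isCompact {α : Type*} [TopologicalSpace α] [T2Space α]
    [MeasurableSpace α] [OpensMeasurableSpace α] {μ : Measure α} [IsFiniteMeasureOnCompacts μ]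
    {K : Set α} (hK : IsCompact K) {f : α → ℝ} (hf : ContinuousOn f K) (h0 : ∀ x ∉ K, f x = 0) :
    Integrable f μ :=
  (integrableOn_iff_integrable_of_support_subset fun x hx => by_contra fun h => hx (h0 x h)).1
    (hf.integrableOn_compact hK)

section

variable {E F : Type*} [NormedAddCommGroup E] [NormedSpace ℝ E] [FiniteDimensional ℝ E]
  [MeasurableSpace E] [BorelSpace E] [NormedAddCommGroup F] [InnerProductSpace ℝ F]

/-- Integration by parts against a compactly supported vector field, for a field which is only
defined on an open neighbourhood of the support. -/
theorem setIntegral_inner_fderiv_tsupport {μ : Measure E} [μ.IsAddHaarMeasure]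
    {U : Set E} (hU : IsOpen U) {V P : E → F} (hV : ContDiff ℝ 1 V) (hVc : HasCompactSupport V)
    (hVU : tsupport V ⊆ U) (hP : ContDiffOn ℝ 1 P U) (v : E) :
    IntegrableOn (fun p => inner ℝ (fderiv ℝ V p v) (P p)) (tsupport V) μ ∧
    IntegrableOn (fun p => inner ℝ (V p) (fderiv ℝ P p v)) (tsupport V) μ ∧
    ∫ p in tsupport V, inner ℝ (fderiv ℝ V p v) (P p) ∂μ =
      -∫ p in tsupport V, inner ℝ (V p) (fderiv ℝ P p v) ∂μ := by
  have hV0 : ∀ p ∉ tsupport V, V p = 0 := fun p hp => image_eq_zero_of_notMem_tsupport hp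
  have hV'0 : ∀ p ∉ tsupport V, fderiv ℝ V p v = 0 := fun p hp => by
    have : fderiv ℝ V p = 0 :=
      image_eq_zero_of_notMem_tsupport fun h => hp (tsupport_fderiv_subset ℝ h)
    simp [this]
  have hPc : ContinuousOn P (tsupport V) := hP.continuousOn.mono hVU
  have hP'c : ContinuousOn (fun p => fderiv ℝ P p v) (tsupport V) :=
    ((hP.continuousOn_fderiv_of_isOpen hU le_rfl).mono hVU).clm_apply continuousOn_const
  have hV'c : Continuous fun p => fderiv ℝ V p v :=
    (hV.continuous_fderiv one_ne_zero).clm_apply continuous_const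
  have hi1 : Integrable (fun p => inner ℝ (fderiv ℝ V p v) (P p)) μ :=
    integrable_of_continuousOn_isCompact hVc (hV'c.continuousOn.inner hPc)
      fun p hp => by simp [hV'0 p hp]
  have hi2 : Integrable (fun p => inner ℝ (V p) (fderiv ℝ P p v)) μ :=
    integrable_of_continuousOn_isCompact hVc (hV.continuous.continuousOn.inner hP'c)
      fun p hp => by simp [hV0 p hp]
  have hi3 : Integrable (fun p => inner ℝ (V p) (P p)) μ :=
    integrable_of_continuousOn_isCompact hVc (hV.continuous.continuousOn.inner hPc)
      fun p hp => by simp [hV0 p hp]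
  refine ⟨hi1.integrableOn, hi2.integrableOn, ?_⟩
  -- Both integrands vanish off the support of `V`, so the integrals may be taken over all of `E`,
  -- where translation invariance leaves no boundary term. The values of `P` outside `U` play no
  -- role.
  rw [setIntegral_eq_integral_of_forall_compl_eq_zero fun p hp => by simp [hV'0 p hp],
    setIntegral_eq_integral_of_forall_compl_eq_zero fun p hp => by simp [hV0 p hp]]
  have key := integral_bilinear_hasLineDerivAt_right_eq_neg_left_of_integrable (μ := μ)
    (f := P) (f' := fun p => fderiv ℝ P p v) (g := V) (g' := fun p => fderiv ℝ V p v) (v := v)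
    (B := innerSL ℝ)
    (hi2.congr (.of_forall fun p => real_inner_comm _ _))
    (hi1.congr (.of_forall fun p => real_inner_comm _ _))
    (hi3.congr (.of_forall fun p => real_inner_comm _ _))
    (fun p hp => ((hP.differentiableOn one_ne_zero).differentiableAt
      (hU.mem_nhds (hVU hp))).hasFDerivAt.hasLineDerivAt v)
    (fun p _ => (hV.differentiable one_ne_zero p).hasFDerivAt.hasLineDerivAt v)
  calc ∫ p, inner ℝ (fderiv ℝ V p v) (P p) ∂μ = ∫ p, inner ℝ (P p) (fderiv ℝ V p v) ∂μ :=
        integral_congr_ae (.of_forall fun p => real_inner_comm _ _)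
    _ = -∫ p, inner ℝ (fderiv ℝ P p v) (V p) ∂μ := key
    _ = -∫ p, inner ℝ (V p) (fderiv ℝ P p v) ∂μ :=
        congrArg _ (integral_congr_ae (.of_forall fun p => real_inner_comm _ _))

/-- The fundamental lemma of the calculus of variations for continuous vector fields. -/
theorem eqOn_zero_of_setIntegral_inner_eq_zero [FiniteDimensional ℝ F] {μ : Measure E}
    [IsFiniteMeasureOnCompacts μ] [μ.IsOpenPosMeasure] {U : Set E} (hU : IsOpen U) {Z : E → F}
    (hZ : ContinuousOn Z U)
    (h : ∀ V : E → F, ContDiff ℝ (⊤ : ℕ∞) V → HasCompactSupport V → tsupport V ⊆ U →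
      ∫ p in tsupport V, inner ℝ (V p) (Z p) ∂μ = 0) :
    ∀ p ∈ U, Z p = 0 := by
  -- Constant directions `e` reduce to the scalar lemma, with test fields `g • e`; choosing `e = Z
  -- p` at the end gives `‖Z p‖² = 0`.
  suffices ∀ e : F, Set.EqOn (fun p => inner ℝ e (Z p)) (fun _ => (0 : ℝ)) U from fun p hp =>
    inner_self_eq_zero.1 (this (Z p) hp)
  intro e
  have hc : ContinuousOn (fun p => (inner ℝ e (Z p) : ℝ)) U := continuousOn_const.inner hZ
  refine Measure.eqOn_open_of_ae_eq (μ := μ) ?_ hU hc continuousOn_const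
  refine (ae_restrict_iff' hU.measurableSet).2 ?_
  refine hU.ae_eq_zero_of_integral_contDiff_smul_eq_zero
    (hc.locallyIntegrableOn hU.measurableSet) fun g hg hgc hgU => ?_
  have hsupp : tsupport (fun p => g p • e) ⊆ tsupport g := tsupport_smul_subset_left g _
  have := h (fun p => g p • e) (hg.smul contDiff_const) hgc.smul_right (hsupp.trans hgU)
  rw [setIntegral_eq_integral_of_forall_compl_eq_zero] at this
  · simpa [real_inner_smul_left] using this
  · intro p hp
    have : g p • e = 0 := image_eq_zero_of_notMem_tsupport (f := fun p => g p • e) hp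
    simp [this]

end

/-! ### Algebra, continuity and smoothness of the cross product. -/

theorem cross3_apply_zero (u v : EuclideanSpace ℝ (Fin 3)) :
    cross3 u v 0 = u 1 * v 2 - u 2 * v 1 := by simp [cross3, cross_apply]

theorem cross3_apply_one (u v : EuclideanSpace ℝ (Fin 3)) :
    cross3 u v 1 = u 2 * v 0 - u 0 * v 2 := by simp [cross3, cross_apply]

theorem cross3_apply_two (u v : EuclideanSpace ℝ (Fin 3)) :
    cross3 u v 2 = u 0 * v 1 - u 1 * v 0 := by simp [cross3, cross_apply]

theorem euclidean3_ext {u v : EuclideanSpace ℝ (Fin 3)} (h0 : u 0 = v 0) (h1 : u 1 = v 1)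
    (h2 : u 2 = v 2) : u = v := by
  ext i; fin_cases i <;> assumption

theorem euclidean3_inner (u v : EuclideanSpace ℝ (Fin 3)) :
    inner ℝ u v = u 0 * v 0 + u 1 * v 1 + u 2 * v 2 := by
  simp [PiLp.inner_apply, Fin.sum_univ_three, mul_comm]

/-- By bilinearity the normal of `X + ε V` is a quadratic polynomial in `ε`; its linear coefficient
is what enters the first variation. -/
theorem cross3_add_smul (u v w z : EuclideanSpace ℝ (Fin 3)) (ε : ℝ) :
    cross3 (u + ε • v) (w + ε • z) =
      cross3 u w + (ε • (cross3 v w + cross3 u z) + ε ^ 2 • cross3 v z) := by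
  apply euclidean3_ext <;>
  simp only [cross3_apply_zero, cross3_apply_one, cross3_apply_two, PiLp.add_apply,
    PiLp.smul_apply, smul_eq_mul] <;> ring

/-- The scalar triple product is cyclic. -/
theorem inner_cross3_cyclic (u v w : EuclideanSpace ℝ (Fin 3)) :
    inner ℝ u (cross3 v w) = inner ℝ v (cross3 w u) := by
  simp only [euclidean3_inner, cross3_apply_zero, cross3_apply_one, cross3_apply_two]; ring

theorem continuous_cross3 :
    Continuous fun q : EuclideanSpace ℝ (Fin 3) × EuclideanSpace ℝ (Fin 3) =>
      cross3 q.1 q.2 := by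
  refine (PiLp.continuous_toLp 2 _).comp (continuous_pi fun i => ?_)
  fin_cases i <;> simp only [cross_apply] <;> simp <;> fun_prop

theorem ContinuousOn.cross3 {α : Type*} [TopologicalSpace α]
    {f g : α → EuclideanSpace ℝ (Fin 3)} {s : Set α} (hf : ContinuousOn f s)
    (hg : ContinuousOn g s) : ContinuousOn (fun x => cross3 (f x) (g x)) s :=
  continuous_cross3.comp_continuousOn (hf.prodMk hg)

theorem ContDiffOn.cross3 {E : Type*} [NormedAddCommGroup E] [NormedSpace ℝ E] {n : WithTop ℕ∞}
    {f g : E → EuclideanSpace ℝ (Fin 3)} {s : Set E} (hf : ContDiffOn ℝ n f s)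
    (hg : ContDiffOn ℝ n g s) : ContDiffOn ℝ n (fun x => cross3 (f x) (g x)) s := by
  rw [contDiffOn_euclidean] at hf hg ⊢
  intro i
  fin_cases i
  · simpa only [cross3_apply_zero, Fin.zero_eta] using
      ((hf 1).mul (hg 2)).sub ((hf 2).mul (hg 1))
  · simpa only [cross3_apply_one, Fin.mk_one] using
      ((hf 2).mul (hg 0)).sub ((hf 0).mul (hg 2))
  · simpa only [cross3_apply_two, Fin.reduceFinMk] using
      ((hf 0).mul (hg 1)).sub ((hf 1).mul (hg 0))

/-! ### The first variation in divergence form, and uniqueness of the curvature. -/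

/-- The positively homogeneous extension of an anisotropic density. -/
noncomputable def homogeneousExtension (Γ : EuclideanSpace ℝ (Fin 3) → ℝ)
    (v : EuclideanSpace ℝ (Fin 3)) : ℝ :=
  Γ (‖v‖⁻¹ • v) * ‖v‖

theorem continuousOn_surfaceNormal {U : Set (ℝ × ℝ)} (hU : IsOpen U)
    {X : ℝ × ℝ → EuclideanSpace ℝ (Fin 3)} (hX : ContDiffOn ℝ 1 X U) :
    ContinuousOn (surfaceNormal X) U := by
  have hX' : ∀ v, ContinuousOn (fun p => fderiv ℝ X p v) U := fun v =>
    (hX.continuousOn_fderiv_of_isOpen hU le_rfl).clm_apply continuousOn_const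
  exact (hX' (1, 0)).cross3 (hX' (0, 1))

/-- The first variation of an anisotropic energy, before integration by parts. -/
theorem hasDerivAt_anisotropicEnergy {Γ : EuclideanSpace ℝ (Fin 3) → ℝ}
    {Ω : Set (EuclideanSpace ℝ (Fin 3))} (hΩ : IsOpen Ω)
    (hG : ContDiffOn ℝ 1 (homogeneousExtension Γ) Ω) {U : Set (ℝ × ℝ)} (hU : IsOpen U)
    {X V : ℝ × ℝ → EuclideanSpace ℝ (Fin 3)} (hX : ContDiffOn ℝ 1 X U)
    (hN : ∀ p ∈ U, surfaceNormal X p ∈ Ω) (hV : ContDiff ℝ 1 V) (hVc : HasCompactSupport V)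
    (hVU : tsupport V ⊆ U) :
    HasDerivAt (fun ε : ℝ => anisotropicEnergy Γ (fun p => X p + ε • V p) (tsupport V))
      (∫ p in tsupport V, fderiv ℝ (homogeneousExtension Γ) (surfaceNormal X p)
        (cross3 (fderiv ℝ V p (1, 0)) (fderiv ℝ X p (0, 1)) +
          cross3 (fderiv ℝ X p (1, 0)) (fderiv ℝ V p (0, 1)))) 0 := by
  set A : ℝ × ℝ → EuclideanSpace ℝ (Fin 3) := surfaceNormal X with hA
  set B : ℝ × ℝ → EuclideanSpace ℝ (Fin 3) := fun p =>
    cross3 (fderiv ℝ V p (1, 0)) (fderiv ℝ X p (0, 1)) +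
      cross3 (fderiv ℝ X p (1, 0)) (fderiv ℝ V p (0, 1)) with hB
  set D : ℝ × ℝ → EuclideanSpace ℝ (Fin 3) := fun p =>
    cross3 (fderiv ℝ V p (1, 0)) (fderiv ℝ V p (0, 1)) with hD
  set M : (ℝ × ℝ) × ℝ → EuclideanSpace ℝ (Fin 3) := fun q =>
    A q.1 + (q.2 • B q.1 + q.2 ^ 2 • D q.1) with hM
  have hX' : ∀ v, ContinuousOn (fun p => fderiv ℝ X p v) U := fun v =>
    (hX.continuousOn_fderiv_of_isOpen hU le_rfl).clm_apply continuousOn_const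
  have hV' : ∀ v, ContinuousOn (fun p => fderiv ℝ V p v) U := fun v =>
    ((hV.continuous_fderiv one_ne_zero).clm_apply continuous_const).continuousOn
  have hAc : ContinuousOn A U := continuousOn_surfaceNormal hU hX
  have hBc : ContinuousOn B U :=
    ((hV' (1, 0)).cross3 (hX' (0, 1))).add ((hX' (1, 0)).cross3 (hV' (0, 1)))
  have hDc : ContinuousOn D U := (hV' (1, 0)).cross3 (hV' (0, 1))
  have hfst : Set.MapsTo Prod.fst (U ×ˢ (Set.univ : Set ℝ)) U := fun q hq => hq.1
  have lift : ∀ {f : ℝ × ℝ → EuclideanSpace ℝ (Fin 3)}, ContinuousOn f U →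
      ContinuousOn (fun q : (ℝ × ℝ) × ℝ => f q.1) (U ×ˢ Set.univ) := fun hf =>
    hf.comp continuous_fst.continuousOn hfst
  have hMc : ContinuousOn M (U ×ˢ Set.univ) :=
    (lift hAc).add ((continuousOn_snd.smul (lift hBc)).add
      ((continuousOn_snd.pow 2).smul (lift hDc)))
  have hnormal : ∀ p ∈ U, ∀ ε : ℝ,
      surfaceNormal (fun p => X p + ε • V p) p = M (p, ε) := by
    intro p hp ε
    have hXd : DifferentiableAt ℝ X p :=
      (hX.differentiableOn one_ne_zero).differentiableAt (hU.mem_nhds hp)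
    have hVd : DifferentiableAt ℝ V p := hV.differentiable one_ne_zero p
    have hsum : fderiv ℝ (fun p => X p + ε • V p) p = fderiv ℝ X p + ε • fderiv ℝ V p :=
      (hXd.hasFDerivAt.add (hVd.hasFDerivAt.const_smul ε)).fderiv
    rw [surfaceNormal, hsum]
    exact cross3_add_smul _ _ _ _ ε
  -- The pairs `(p, ε)` for which the perturbed normal stays in `Ω`, where `G` is differentiable.
  -- This set is open and contains the slice `ε = 0` over the support.
  set W : Set ((ℝ × ℝ) × ℝ) := U ×ˢ Set.univ ∩ M ⁻¹' Ω with hWdef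
  have hW : IsOpen W := hMc.isOpen_inter_preimage (hU.prod isOpen_univ) hΩ
  have hM0 : ∀ p, M (p, 0) = A p := fun p => by simp [hM]
  have hKW : tsupport V ×ˢ {(0 : ℝ)} ⊆ W := by
    rintro ⟨p, ε⟩ ⟨hp, rfl : ε = 0⟩
    exact ⟨⟨hVU hp, trivial⟩, by simpa only [Set.mem_preimage, hM0] using hN p (hVU hp)⟩
  have hMW : ContinuousOn M W := hMc.mono Set.inter_subset_left
  have hMmaps : Set.MapsTo M W Ω := fun q hq => hq.2
  have hG' := hG.continuousOn_fderiv_of_isOpen hΩ le_rfl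
  have main := hasDerivAt_setIntegral_of_isCompact (μ := volume) (a := 0) hVc.isCompact hW hKW
    (F := fun q => homogeneousExtension Γ (M q))
    (F' := fun q => fderiv ℝ (homogeneousExtension Γ) (M q) (B q.1 + (2 * q.2) • D q.1))
    ((hG.continuousOn.comp hMW hMmaps).mono Set.inter_subset_left)
    (((hG'.comp hMW hMmaps).clm_apply (((lift hBc).add
      ((continuousOn_const.mul continuousOn_snd).smul (lift hDc))).mono
        Set.inter_subset_left)).mono Set.inter_subset_left) ?_
  · refine (main.congr_deriv ?_).congr_of_eventuallyEq (.of_forall fun ε => ?_)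
    · simp only [hM0, mul_zero, zero_smul, add_zero]
      rfl
    · refine setIntegral_congr_fun hVc.isCompact.measurableSet fun p hp => ?_
      simp only [gaussMap, hnormal p (hVU hp), homogeneousExtension]
  · intro p hp ε hε
    have hMd : HasDerivAt (fun e => M (p, e)) (B p + (2 * ε) • D p) ε := by
      have h1 : HasDerivAt (fun e : ℝ => e • B p) (B p) ε := by
        simpa using (hasDerivAt_id ε).smul_const (B p)
      have h2 : HasDerivAt (fun e : ℝ => e ^ 2 • D p) ((2 * ε) • D p) ε := by
        simpa using (hasDerivAt_pow 2 ε).smul_const (D p)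
      exact (h1.add h2).const_add (A p)
    exact (((hG.differentiableOn one_ne_zero).differentiableAt
      (hΩ.mem_nhds hε.2)).hasFDerivAt).comp_hasDerivAt ε hMd

/-- A surface whose Cahn–Hoffman field `ξ = ∇G(N)` satisfies
`∂_s (X_ϑ × ξ) + ∂_ϑ (ξ × X_s) = Λ N` has anisotropic mean curvature `Λ`. -/
theorem hasAnisotropicMeanCurvature_of_divergence {Γ : EuclideanSpace ℝ (Fin 3) → ℝ}
    {Ω : Set (EuclideanSpace ℝ (Fin 3))} (hΩ : IsOpen Ω)
    (hG : ContDiffOn ℝ 1 (homogeneousExtension Γ) Ω) {U : Set (ℝ × ℝ)} (hU : IsOpen U)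
    {X ξ : ℝ × ℝ → EuclideanSpace ℝ (Fin 3)} (hX : ContDiffOn ℝ 2 X U)
    (hN : ∀ p ∈ U, surfaceNormal X p ∈ Ω) (hN0 : ∀ p ∈ U, surfaceNormal X p ≠ 0)
    (hξ : ContDiffOn ℝ 1 ξ U)
    (hξG : ∀ p ∈ U, ∀ w,
      fderiv ℝ (homogeneousExtension Γ) (surfaceNormal X p) w = inner ℝ (ξ p) w)
    {Λ : ℝ × ℝ → ℝ}
    (hdiv : ∀ p ∈ U, fderiv ℝ (fun q => cross3 (fderiv ℝ X q (0, 1)) (ξ q)) p (1, 0) +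
      fderiv ℝ (fun q => cross3 (ξ q) (fderiv ℝ X q (1, 0))) p (0, 1) =
        Λ p • surfaceNormal X p) :
    HasAnisotropicMeanCurvature Γ U X Λ := by
  intro V hV hVc hVU
  have hV1 : ContDiff ℝ 1 V := hV.of_le (by exact_mod_cast le_top)
  refine (hasDerivAt_anisotropicEnergy hΩ hG hU (hX.of_le one_le_two) hN hV1 hVc
    hVU).congr_deriv ?_
  have hX' : ∀ v, ContDiffOn ℝ 1 (fun p => fderiv ℝ X p v) U := fun v =>
    (hX.fderiv_of_isOpen hU (by norm_num)).clm_apply contDiffOn_const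
  obtain ⟨hi1, hj1, h1⟩ := setIntegral_inner_fderiv_tsupport (μ := volume) hU hV1 hVc hVU
    ((hX' (0, 1)).cross3 hξ) (1, 0)
  obtain ⟨hi2, hj2, h2⟩ := setIntegral_inner_fderiv_tsupport (μ := volume) hU hV1 hVc hVU
    (hξ.cross3 (hX' (1, 0))) (0, 1)
  have hK : MeasurableSet (tsupport V) := hVc.isCompact.measurableSet
  calc _ = ∫ p in tsupport V,
        (inner ℝ (fderiv ℝ V p (1, 0)) (cross3 (fderiv ℝ X p (0, 1)) (ξ p)) +
          inner ℝ (fderiv ℝ V p (0, 1)) (cross3 (ξ p) (fderiv ℝ X p (1, 0)))) := by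
        refine setIntegral_congr_fun hK fun p hp => ?_
        simp only [hξG p (hVU hp), inner_add_right]
        -- Cyclic permutation isolates the derivatives of `V`, ready for integration by parts in
        -- each variable.
        rw [inner_cross3_cyclic (ξ p), inner_cross3_cyclic (ξ p),
          inner_cross3_cyclic (fderiv ℝ X p (1, 0))]
    _ = -∫ p in tsupport V,
        (inner ℝ (V p) (fderiv ℝ (fun q => cross3 (fderiv ℝ X q (0, 1)) (ξ q)) p (1, 0)) +
          inner ℝ (V p)
            (fderiv ℝ (fun q => cross3 (ξ q) (fderiv ℝ X q (1, 0))) p (0, 1))) := by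
        rw [integral_add hi1 hi2, integral_add hj1 hj2, h1, h2, neg_add]
    _ = _ := by
        refine congrArg _ (setIntegral_congr_fun hK fun p hp => ?_)
        have h0 : ‖surfaceNormal X p‖ ≠ 0 := norm_ne_zero_iff.2 (hN0 p (hVU hp))
        simp only [← inner_add_right, hdiv p (hVU hp), gaussMap, real_inner_smul_right]
        field_simp

/-- The anisotropic mean curvature of an immersed surface is unique, among continuous functions. -/
theorem HasAnisotropicMeanCurvature.eqOn {Γ : EuclideanSpace ℝ (Fin 3) → ℝ}
    {U : Set (ℝ × ℝ)} (hU : IsOpen U) {X : ℝ × ℝ → EuclideanSpace ℝ (Fin 3)}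
    (hX : ContDiffOn ℝ 1 X U) (hN0 : ∀ p ∈ U, surfaceNormal X p ≠ 0) {Λ₁ Λ₂ : ℝ × ℝ → ℝ}
    (hΛ₁ : ContinuousOn Λ₁ U) (hΛ₂ : ContinuousOn Λ₂ U)
    (h₁ : HasAnisotropicMeanCurvature Γ U X Λ₁) (h₂ : HasAnisotropicMeanCurvature Γ U X Λ₂) :
    Set.EqOn Λ₁ Λ₂ U := by
  have hNc : ContinuousOn (surfaceNormal X) U := continuousOn_surfaceNormal hU hX
  have hZ : ∀ {Λ : ℝ × ℝ → ℝ}, ContinuousOn Λ U →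
      ContinuousOn (fun p => Λ p • surfaceNormal X p) U := fun h => h.smul hNc
  have key : ∀ p ∈ U, Λ₁ p • surfaceNormal X p - Λ₂ p • surfaceNormal X p = 0 := by
    refine eqOn_zero_of_setIntegral_inner_eq_zero (μ := (volume : Measure (ℝ × ℝ))) hU
      (Z := fun p => Λ₁ p • surfaceNormal X p - Λ₂ p • surfaceNormal X p)
      ((hZ hΛ₁).sub (hZ hΛ₂)) fun V hV hVc hVU => ?_
    have hK : MeasurableSet (tsupport V) := hVc.isCompact.measurableSet
    have hval : ∀ Λ : ℝ × ℝ → ℝ,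
        ∫ p in tsupport V, Λ p * inner ℝ (V p) (gaussMap X p) * ‖surfaceNormal X p‖ =
          ∫ p in tsupport V, inner ℝ (V p) (Λ p • surfaceNormal X p) := fun Λ =>
      setIntegral_congr_fun hK fun p hp => by
        have h0 : ‖surfaceNormal X p‖ ≠ 0 := norm_ne_zero_iff.2 (hN0 p (hVU hp))
        simp only [gaussMap, real_inner_smul_right]
        field_simp
    have hint : ∀ {Λ : ℝ × ℝ → ℝ}, ContinuousOn Λ U →
        IntegrableOn (fun p => inner ℝ (V p) (Λ p • surfaceNormal X p)) (tsupport V) := fun h =>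
      (hV.continuous.continuousOn.inner ((hZ h).mono hVU)).integrableOn_compact hVc
    -- Both formulas give the derivative of one and the same energy function of `ε`, so the two
    -- integrals agree.
    have heq := neg_injective ((h₁ V hV hVc hVU).unique (h₂ V hV hVc hVU))
    rw [hval, hval] at heq
    simp only [inner_sub_right]
    rw [integral_sub (hint hΛ₁) (hint hΛ₂), heq, sub_self]
  intro p hp
  have := key p hp
  rwa [← sub_smul, smul_eq_zero, or_iff_left (hN0 p hp), sub_eq_zero] at this

theorem HasAnisotropicMeanCurvature.congr {Γ : EuclideanSpace ℝ (Fin 3) → ℝ}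
    {U : Set (ℝ × ℝ)} {X : ℝ × ℝ → EuclideanSpace ℝ (Fin 3)} {Λ₁ Λ₂ : ℝ × ℝ → ℝ}
    (h : HasAnisotropicMeanCurvature Γ U X Λ₁) (hΛ : Set.EqOn Λ₁ Λ₂ U) :
    HasAnisotropicMeanCurvature Γ U X Λ₂ := fun V hV hVc hVU =>
  (h V hV hVc hVU).congr_deriv <| congrArg _ <|
    setIntegral_congr_fun hVc.isCompact.measurableSet fun p hp => by simp only [hΛ (hVU hp)]

/-! ### Axially symmetric densities away from the vertical directions. -/

/-- Vectors of Euclidean 3-space which are not vertical. -/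
def nonverticalVectors : Set (EuclideanSpace ℝ (Fin 3)) := {v | |v 2| < ‖v‖}

theorem isOpen_nonverticalVectors : IsOpen nonverticalVectors :=
  isOpen_lt (by fun_prop) continuous_norm

theorem nonverticalVectors_norm_pos {v : EuclideanSpace ℝ (Fin 3)}
    (hv : v ∈ nonverticalVectors) : 0 < ‖v‖ :=
  (abs_nonneg _).trans_lt hv

/-- The strict bound keeps `γ` evaluated inside the open interval, where its derivative is
two-sided; at the poles `G` need not be smooth. -/
theorem nonverticalVectors_slope_mem {v : EuclideanSpace ℝ (Fin 3)}
    (hv : v ∈ nonverticalVectors) : ‖v‖⁻¹ * v 2 ∈ Set.Ioo (-1 : ℝ) 1 := by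
  have h0 := nonverticalVectors_norm_pos hv
  rw [Set.mem_Ioo, ← abs_lt, abs_mul, abs_of_pos (inv_pos.2 h0), inv_mul_lt_one₀ h0]
  exact hv

theorem homogeneousExtension_axial (γ : ℝ → ℝ) :
    homogeneousExtension (fun ν => γ (ν 2)) = fun v => γ (‖v‖⁻¹ * v 2) * ‖v‖ := by
  ext v; simp [homogeneousExtension]

theorem contDiffOn_homogeneousExtension_axial {γ : ℝ → ℝ} {n : WithTop ℕ∞}
    (hγ : ContDiffOn ℝ n γ (Set.Ioo (-1) 1)) :
    ContDiffOn ℝ n (homogeneousExtension fun ν => γ (ν 2)) nonverticalVectors := by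
  rw [homogeneousExtension_axial]
  have hnorm : ContDiffOn ℝ n (fun v : EuclideanSpace ℝ (Fin 3) => ‖v‖) nonverticalVectors :=
    fun v hv => (contDiffAt_norm ℝ
      (norm_pos_iff.1 (nonverticalVectors_norm_pos hv))).contDiffWithinAt
  have hcoord : ContDiffOn ℝ n (fun v : EuclideanSpace ℝ (Fin 3) => v 2) nonverticalVectors :=
    contDiffOn_euclidean.1 contDiffOn_id 2
  exact (hγ.comp ((hnorm.inv fun v hv => (nonverticalVectors_norm_pos hv).ne').mul hcoord)
    fun v hv => nonverticalVectors_slope_mem hv).mul hnorm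

/-- The gradient of the homogeneous extension of an axially symmetric density. -/
theorem fderiv_homogeneousExtension_axial {γ : ℝ → ℝ}
    (hγ : ContDiffOn ℝ 1 γ (Set.Ioo (-1) 1)) {v : EuclideanSpace ℝ (Fin 3)}
    (hv : v ∈ nonverticalVectors) (w : EuclideanSpace ℝ (Fin 3)) :
    fderiv ℝ (homogeneousExtension fun ν => γ (ν 2)) v w =
      (γ (‖v‖⁻¹ * v 2) - ‖v‖⁻¹ * v 2 * deriv γ (‖v‖⁻¹ * v 2)) / ‖v‖ * inner ℝ v w +
        deriv γ (‖v‖⁻¹ * v 2) * w 2 := by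
  have h0 := nonverticalVectors_norm_pos hv
  -- Differentiability of `G` is already known, so its derivative can be read off along lines, which
  -- leaves a one-variable computation.
  have hline : HasDerivAt (fun ε : ℝ => v + ε • w) w 0 := by
    simpa using ((hasDerivAt_id (0 : ℝ)).smul_const w).const_add v
  have hG : HasFDerivAt (homogeneousExtension fun ν => γ (ν 2))
      (fderiv ℝ (homogeneousExtension fun ν => γ (ν 2)) v) (v + (0 : ℝ) • w) := by
    rw [zero_smul, add_zero]
    exact (((contDiffOn_homogeneousExtension_axial hγ).differentiableOn
      one_ne_zero).differentiableAt (isOpen_nonverticalVectors.mem_nhds hv)).hasFDerivAt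
  refine (hG.comp_hasDerivAt (0 : ℝ) hline).unique ?_
  rw [homogeneousExtension_axial]
  have hnorm : HasDerivAt (fun ε : ℝ => ‖v + ε • w‖) (inner ℝ v w / ‖v‖) 0 := by
    have h1 := (hline.norm_sq).sqrt (by simpa using h0.ne')
    simp only [Real.sqrt_sq (norm_nonneg _), zero_smul, add_zero] at h1
    refine h1.congr_deriv ?_
    field_simp
  have hcoord : HasDerivAt (fun ε : ℝ => (v + ε • w) 2) (w 2) 0 := by
    simpa using ((hasDerivAt_id (0 : ℝ)).mul_const (w 2)).const_add (v 2)
  have hquot : HasDerivAt (fun ε : ℝ => ‖v + ε • w‖⁻¹ * (v + ε • w) 2)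
      (-(inner ℝ v w / ‖v‖) / ‖v‖ ^ 2 * v 2 + ‖v‖⁻¹ * w 2) 0 := by
    have h1 := (hnorm.inv (by simpa using h0.ne')).mul hcoord
    exact h1.congr_deriv (by simp)
  have hγd : HasDerivAt γ (deriv γ (‖v‖⁻¹ * v 2)) (‖v + (0 : ℝ) • w‖⁻¹ * (v + (0 : ℝ) • w) 2) := by
    rw [zero_smul, add_zero]
    exact ((hγ.differentiableOn one_ne_zero).differentiableAt
      (isOpen_Ioo.mem_nhds (nonverticalVectors_slope_mem hv))).hasDerivAt
  refine ((hγd.comp (0 : ℝ) hquot).mul hnorm).congr_deriv ?_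
  simp only [Function.comp, zero_smul, add_zero]
  field_simp
  ring

theorem fderiv_apply_one_zero {f : ℝ × ℝ → EuclideanSpace ℝ (Fin 3)} {p : ℝ × ℝ}
    (hf : DifferentiableAt ℝ f p) {a b c : ℝ}
    (h0 : HasDerivAt (fun s => f (s, p.2) 0) a p.1)
    (h1 : HasDerivAt (fun s => f (s, p.2) 1) b p.1)
    (h2 : HasDerivAt (fun s => f (s, p.2) 2) c p.1) :
    fderiv ℝ f p (1, 0) = !₂[a, b, c] := by
  have hl : HasDerivAt (fun s : ℝ => (s, p.2)) ((1 : ℝ), (0 : ℝ)) p.1 :=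
    (hasDerivAt_id _).prodMk (hasDerivAt_const _ _)
  have hd : HasDerivAt (fun s => f (s, p.2)) (fderiv ℝ f p (1, 0)) p.1 :=
    (show HasFDerivAt f (fderiv ℝ f p) (p.1, p.2) from hf.hasFDerivAt).comp_hasDerivAt p.1 hl
  have hi : ∀ i, HasDerivAt (fun s => f (s, p.2) i) (fderiv ℝ f p (1, 0) i) p.1 := fun i =>
    (PiLp.proj 2 (fun _ : Fin 3 => ℝ) (𝕜 := ℝ) i).hasFDerivAt.comp_hasDerivAt p.1 hd
  exact euclidean3_ext ((hi 0).unique h0) ((hi 1).unique h1) ((hi 2).unique h2)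

theorem fderiv_apply_zero_one {f : ℝ × ℝ → EuclideanSpace ℝ (Fin 3)} {p : ℝ × ℝ}
    (hf : DifferentiableAt ℝ f p) {a b c : ℝ}
    (h0 : HasDerivAt (fun s => f (p.1, s) 0) a p.2)
    (h1 : HasDerivAt (fun s => f (p.1, s) 1) b p.2)
    (h2 : HasDerivAt (fun s => f (p.1, s) 2) c p.2) :
    fderiv ℝ f p (0, 1) = !₂[a, b, c] := by
  have hl : HasDerivAt (fun s : ℝ => (p.1, s)) ((0 : ℝ), (1 : ℝ)) p.2 :=
    (hasDerivAt_const _ _).prodMk (hasDerivAt_id _)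
  have hd : HasDerivAt (fun s => f (p.1, s)) (fderiv ℝ f p (0, 1)) p.2 :=
    (show HasFDerivAt f (fderiv ℝ f p) (p.1, p.2) from hf.hasFDerivAt).comp_hasDerivAt p.2 hl
  have hi : ∀ i, HasDerivAt (fun s => f (p.1, s) i) (fderiv ℝ f p (0, 1) i) p.2 := fun i =>
    (PiLp.proj 2 (fun _ : Fin 3 => ℝ) (𝕜 := ℝ) i).hasFDerivAt.comp_hasDerivAt p.2 hd
  exact euclidean3_ext ((hi 0).unique h0) ((hi 1).unique h1) ((hi 2).unique h2)

/-! ### The treadmill sled, curvature and Cahn–Hoffman components along the generating curve. -/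

/-- The third component of the Gauss map of a helicoidal surface. -/
noncomputable def helicoidalSlope (x y : ℝ → ℝ) (ω s : ℝ) : ℝ :=
  ω * treadmill₁ x y s / Real.sqrt (1 + ω ^ 2 * treadmill₁ x y s ^ 2)

/-- The horizontal size of the Cahn–Hoffman field of a helicoidal surface. -/
noncomputable def cahnHoffmanHorizontal (γ x y : ℝ → ℝ) (ω s : ℝ) : ℝ :=
  (γ (helicoidalSlope x y ω s) - helicoidalSlope x y ω s * deriv γ (helicoidalSlope x y ω s)) /
    Real.sqrt (1 + ω ^ 2 * treadmill₁ x y s ^ 2)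

/-- The vertical component of the Cahn–Hoffman field of a helicoidal surface. -/
noncomputable def cahnHoffmanVertical (γ x y : ℝ → ℝ) (ω s : ℝ) : ℝ :=
  cahnHoffmanHorizontal γ x y ω s * (ω * treadmill₁ x y s) + deriv γ (helicoidalSlope x y ω s)

/-- The signed curvature of a plane curve parametrized by arc length. -/
noncomputable def arcCurvature (x y : ℝ → ℝ) (s : ℝ) : ℝ :=
  deriv x s * deriv (deriv y) s - deriv y s * deriv (deriv x) s

/-- The anisotropic mean curvature of a helicoidal surface. -/
noncomputable def helicoidalAMC (γ x y : ℝ → ℝ) (ω s : ℝ) : ℝ :=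
  -(cahnHoffmanHorizontal γ x y ω s * arcCurvature x y s +
    ω * deriv (cahnHoffmanVertical γ x y ω) s * treadmill₂ x y s)

theorem ContDiffOn.deriv_smooth {f : ℝ → ℝ} {s : Set ℝ} (hf : ContDiffOn ℝ (⊤ : ℕ∞) f s)
    (hs : IsOpen s) : ContDiffOn ℝ (⊤ : ℕ∞) (deriv f) s :=
  hf.deriv_of_isOpen hs (by simp)

theorem ContDiffOn.hasDerivAt_of_isOpen {f : ℝ → ℝ} {s : Set ℝ} {t : ℝ}
    (hf : ContDiffOn ℝ (⊤ : ℕ∞) f s) (hs : IsOpen s) (ht : t ∈ s) :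
    HasDerivAt f (deriv f t) t :=
  ((hf.differentiableOn (by simp)).differentiableAt (hs.mem_nhds ht)).hasDerivAt

section

variable {γ x y : ℝ → ℝ} {J : Set ℝ} {ω s : ℝ}

theorem one_add_sq_pos (a b : ℝ) : 0 < 1 + a ^ 2 * b ^ 2 := by positivity

theorem sqrt_one_add_pos (a b : ℝ) : 0 < Real.sqrt (1 + a ^ 2 * b ^ 2) :=
  Real.sqrt_pos.2 (one_add_sq_pos a b)

theorem helicoidalSlope_mem_Ioo (x y : ℝ → ℝ) (ω s : ℝ) :
    helicoidalSlope x y ω s ∈ Set.Ioo (-1 : ℝ) 1 := by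
  have h := sqrt_one_add_pos ω (treadmill₁ x y s)
  rw [helicoidalSlope, Set.mem_Ioo, ← abs_lt, abs_div, abs_of_pos h, div_lt_one h]
  refine Real.lt_sqrt_of_sq_lt ?_
  rw [sq_abs, mul_pow]
  linarith

theorem contDiffOn_treadmill₁ (hJo : IsOpen J) (hx : ContDiffOn ℝ (⊤ : ℕ∞) x J)
    (hy : ContDiffOn ℝ (⊤ : ℕ∞) y J) : ContDiffOn ℝ (⊤ : ℕ∞) (treadmill₁ x y) J :=
  contDiffOn_const.mul (((hx.pow 2).add (hy.pow 2)).deriv_smooth hJo)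

theorem contDiffOn_treadmill₂ (hJo : IsOpen J) (hx : ContDiffOn ℝ (⊤ : ℕ∞) x J)
    (hy : ContDiffOn ℝ (⊤ : ℕ∞) y J) : ContDiffOn ℝ (⊤ : ℕ∞) (treadmill₂ x y) J :=
  (hx.mul (hy.deriv_smooth hJo)).sub (hy.mul (hx.deriv_smooth hJo))

theorem contDiffOn_sqrt_one_add (hJo : IsOpen J) (hx : ContDiffOn ℝ (⊤ : ℕ∞) x J)
    (hy : ContDiffOn ℝ (⊤ : ℕ∞) y J) :
    ContDiffOn ℝ (⊤ : ℕ∞) (fun s => Real.sqrt (1 + ω ^ 2 * treadmill₁ x y s ^ 2)) J :=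
  (contDiffOn_const.add (contDiffOn_const.mul ((contDiffOn_treadmill₁ hJo hx hy).pow 2))).sqrt
    fun _ _ => (one_add_sq_pos _ _).ne'

theorem contDiffOn_helicoidalSlope (hJo : IsOpen J) (hx : ContDiffOn ℝ (⊤ : ℕ∞) x J)
    (hy : ContDiffOn ℝ (⊤ : ℕ∞) y J) : ContDiffOn ℝ (⊤ : ℕ∞) (helicoidalSlope x y ω) J :=
  (contDiffOn_const.mul (contDiffOn_treadmill₁ hJo hx hy)).div (contDiffOn_sqrt_one_add hJo hx hy)
    fun _ _ => (sqrt_one_add_pos _ _).ne'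

theorem contDiffOn_cahnHoffmanHorizontal (hγ : ContDiffOn ℝ (⊤ : ℕ∞) γ (Set.Ioo (-1) 1))
    (hJo : IsOpen J) (hx : ContDiffOn ℝ (⊤ : ℕ∞) x J) (hy : ContDiffOn ℝ (⊤ : ℕ∞) y J) :
    ContDiffOn ℝ (⊤ : ℕ∞) (cahnHoffmanHorizontal γ x y ω) J := by
  have ht := contDiffOn_helicoidalSlope (ω := ω) hJo hx hy
  have hm : Set.MapsTo (helicoidalSlope x y ω) J (Set.Ioo (-1) 1) := fun s _ =>
    helicoidalSlope_mem_Ioo x y ω s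
  exact ((hγ.comp ht hm).sub (ht.mul ((hγ.deriv_smooth isOpen_Ioo).comp ht hm))).div
    (contDiffOn_sqrt_one_add hJo hx hy) fun _ _ => (sqrt_one_add_pos _ _).ne'

theorem contDiffOn_cahnHoffmanVertical (hγ : ContDiffOn ℝ (⊤ : ℕ∞) γ (Set.Ioo (-1) 1))
    (hJo : IsOpen J) (hx : ContDiffOn ℝ (⊤ : ℕ∞) x J) (hy : ContDiffOn ℝ (⊤ : ℕ∞) y J) :
    ContDiffOn ℝ (⊤ : ℕ∞) (cahnHoffmanVertical γ x y ω) J :=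
  ((contDiffOn_cahnHoffmanHorizontal hγ hJo hx hy).mul
    (contDiffOn_const.mul (contDiffOn_treadmill₁ hJo hx hy))).add
      ((hγ.deriv_smooth isOpen_Ioo).comp (contDiffOn_helicoidalSlope hJo hx hy)
        fun s _ => helicoidalSlope_mem_Ioo x y ω s)

theorem contDiffOn_arcCurvature (hJo : IsOpen J) (hx : ContDiffOn ℝ (⊤ : ℕ∞) x J)
    (hy : ContDiffOn ℝ (⊤ : ℕ∞) y J) : ContDiffOn ℝ (⊤ : ℕ∞) (arcCurvature x y) J :=
  ((hx.deriv_smooth hJo).mul ((hy.deriv_smooth hJo).deriv_smooth hJo)).sub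
    ((hy.deriv_smooth hJo).mul ((hx.deriv_smooth hJo).deriv_smooth hJo))

theorem contDiffOn_helicoidalAMC (hγ : ContDiffOn ℝ (⊤ : ℕ∞) γ (Set.Ioo (-1) 1))
    (hJo : IsOpen J) (hx : ContDiffOn ℝ (⊤ : ℕ∞) x J) (hy : ContDiffOn ℝ (⊤ : ℕ∞) y J) :
    ContDiffOn ℝ (⊤ : ℕ∞) (helicoidalAMC γ x y ω) J :=
  (((contDiffOn_cahnHoffmanHorizontal hγ hJo hx hy).mul (contDiffOn_arcCurvature hJo hx hy)).add
    ((contDiffOn_const.mul ((contDiffOn_cahnHoffmanVertical hγ hJo hx hy).deriv_smooth hJo)).mul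
      (contDiffOn_treadmill₂ hJo hx hy))).neg

theorem treadmill₁_eq (hJo : IsOpen J) (hx : ContDiffOn ℝ (⊤ : ℕ∞) x J)
    (hy : ContDiffOn ℝ (⊤ : ℕ∞) y J) (hs : s ∈ J) :
    treadmill₁ x y s = -(x s * deriv x s + y s * deriv y s) := by
  have h := ((hx.hasDerivAt_of_isOpen hJo hs).pow 2).add ((hy.hasDerivAt_of_isOpen hJo hs).pow 2)
  have h' : deriv (fun t => x t ^ 2 + y t ^ 2) s = _ := h.deriv
  rw [treadmill₁, h']
  simp only [Nat.cast_ofNat, Nat.add_one_sub_one, pow_one]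
  ring

/-- The Frenet equations of a plane curve parametrized by arc length. -/
theorem frenet_equations (hJo : IsOpen J) (hx : ContDiffOn ℝ (⊤ : ℕ∞) x J)
    (hy : ContDiffOn ℝ (⊤ : ℕ∞) y J) (harc : ∀ s ∈ J, deriv x s ^ 2 + deriv y s ^ 2 = 1)
    (hs : s ∈ J) :
    deriv (deriv x) s = -(arcCurvature x y s * deriv y s) ∧
      deriv (deriv y) s = arcCurvature x y s * deriv x s := by
  have h1 := ((hx.deriv_smooth hJo).hasDerivAt_of_isOpen hJo hs).pow 2 |>.add
    (((hy.deriv_smooth hJo).hasDerivAt_of_isOpen hJo hs).pow 2)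
  have h2 := h1.unique ((hasDerivAt_const s (1 : ℝ)).congr_of_eventuallyEq
    (Filter.eventuallyEq_of_mem (hJo.mem_nhds hs) harc))
  simp only [Nat.cast_ofNat, Nat.add_one_sub_one, pow_one] at h2
  have h3 := harc s hs
  -- `h2` says that the acceleration is orthogonal to the unit tangent, so it is a multiple of the
  -- rotated tangent; `h3` normalises the factor.
  rw [arcCurvature]
  constructor
  · linear_combination (-deriv (deriv x) s) * h3 + deriv x s / 2 * h2
  · linear_combination (-deriv (deriv y) s) * h3 + deriv y s / 2 * h2

/-- In complex form `w = η₁ + i η₂ = -(x + i y) T̄`, and `T' = i κ T` yields `w' = -1 - i κ w`. This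
is the real part; `hasDerivAt_treadmill₂` is the imaginary part. -/
theorem hasDerivAt_treadmill₁ (hJo : IsOpen J) (hx : ContDiffOn ℝ (⊤ : ℕ∞) x J)
    (hy : ContDiffOn ℝ (⊤ : ℕ∞) y J) (harc : ∀ s ∈ J, deriv x s ^ 2 + deriv y s ^ 2 = 1)
    (hs : s ∈ J) :
    HasDerivAt (treadmill₁ x y) (-1 + arcCurvature x y s * treadmill₂ x y s) s := by
  have h := (((hx.hasDerivAt_of_isOpen hJo hs).mul
    ((hx.deriv_smooth hJo).hasDerivAt_of_isOpen hJo hs)).add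
    ((hy.hasDerivAt_of_isOpen hJo hs).mul
      ((hy.deriv_smooth hJo).hasDerivAt_of_isOpen hJo hs))).neg
  refine (h.congr_deriv ?_).congr_of_eventuallyEq
    (Filter.eventuallyEq_of_mem (hJo.mem_nhds hs) fun t ht => treadmill₁_eq hJo hx hy ht)
  obtain ⟨hx2, hy2⟩ := frenet_equations hJo hx hy harc hs
  rw [hx2, hy2, treadmill₂]
  linear_combination -harc s hs

theorem hasDerivAt_treadmill₂ (hJo : IsOpen J) (hx : ContDiffOn ℝ (⊤ : ℕ∞) x J)
    (hy : ContDiffOn ℝ (⊤ : ℕ∞) y J) (harc : ∀ s ∈ J, deriv x s ^ 2 + deriv y s ^ 2 = 1)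
    (hs : s ∈ J) :
    HasDerivAt (treadmill₂ x y) (-(arcCurvature x y s * treadmill₁ x y s)) s := by
  have h := ((hx.hasDerivAt_of_isOpen hJo hs).mul
    ((hy.deriv_smooth hJo).hasDerivAt_of_isOpen hJo hs)).sub
    ((hy.hasDerivAt_of_isOpen hJo hs).mul
      ((hx.deriv_smooth hJo).hasDerivAt_of_isOpen hJo hs))
  refine h.congr_deriv ?_
  obtain ⟨hx2, hy2⟩ := frenet_equations hJo hx hy harc hs
  rw [hx2, hy2, treadmill₁_eq hJo hx hy hs]
  ring

/-- The identity between the components of the Cahn–Hoffman field along a helicoidal surface which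
expresses that its derivatives are tangent to the surface. -/
theorem deriv_cahnHoffmanHorizontal (hγ : ContDiffOn ℝ (⊤ : ℕ∞) γ (Set.Ioo (-1) 1))
    (hJo : IsOpen J) (hx : ContDiffOn ℝ (⊤ : ℕ∞) x J) (hy : ContDiffOn ℝ (⊤ : ℕ∞) y J)
    (hs : s ∈ J) :
    deriv (cahnHoffmanHorizontal γ x y ω) s =
      -(ω * deriv (cahnHoffmanVertical γ x y ω) s * treadmill₁ x y s) := by
  set η := treadmill₁ x y s with hη
  set r := Real.sqrt (1 + ω ^ 2 * η ^ 2) with hr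
  have hr0 : r ≠ 0 := (sqrt_one_add_pos ω η).ne'
  have hr2 : r ^ 2 = 1 + ω ^ 2 * η ^ 2 := Real.sq_sqrt (one_add_sq_pos ω η).le
  have hη' := (contDiffOn_treadmill₁ hJo hx hy).hasDerivAt_of_isOpen hJo hs
  have hr' := (contDiffOn_sqrt_one_add (ω := ω) hJo hx hy).hasDerivAt_of_isOpen hJo hs
  have ht' := (contDiffOn_helicoidalSlope (ω := ω) hJo hx hy).hasDerivAt_of_isOpen hJo hs
  have hp' := (contDiffOn_cahnHoffmanHorizontal (ω := ω) hγ hJo hx hy).hasDerivAt_of_isOpen hJo hs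
  have hq' := (contDiffOn_cahnHoffmanVertical (ω := ω) hγ hJo hx hy).hasDerivAt_of_isOpen hJo hs
  have hmem := helicoidalSlope_mem_Ioo x y ω s
  have hγ' := (hγ.hasDerivAt_of_isOpen isOpen_Ioo hmem).comp s ht'
  have hγ'' := ((hγ.deriv_smooth isOpen_Ioo).hasDerivAt_of_isOpen isOpen_Ioo hmem).comp s ht'
  set r' := deriv (fun s => Real.sqrt (1 + ω ^ 2 * treadmill₁ x y s ^ 2)) s
  set η' := deriv (treadmill₁ x y) s
  set t := helicoidalSlope x y ω s with ht
  set t' := deriv (helicoidalSlope x y ω) s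
  set p := cahnHoffmanHorizontal γ x y ω s with hp
  set p' := deriv (cahnHoffmanHorizontal γ x y ω) s
  set q' := deriv (cahnHoffmanVertical γ x y ω) s
  have htr : t * r = ω * η := div_mul_cancel₀ _ hr0
  have hpr : p * r = γ t - t * deriv γ t := div_mul_cancel₀ _ hr0
  -- The square root and the quotients are differentiated implicitly, through `r² = 1 + ω² η²` and
  -- `P r = γ - t γ'`.
  have h1 : 2 * r * r' = 2 * ω ^ 2 * η * η' := by
    have a := hr'.pow 2
    have b := ((hη'.pow 2).const_mul (ω ^ 2)).const_add 1
    have := a.unique (b.congr_of_eventuallyEq (.of_forall fun u =>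
      Real.sq_sqrt (one_add_sq_pos ω (treadmill₁ x y u)).le))
    simp only [Nat.cast_ofNat, Nat.add_one_sub_one, pow_one, ← hr, ← hη] at this
    linear_combination this
  have h2 : p' * r + p * r' = deriv γ t * t' - (t' * deriv γ t + t * (deriv (deriv γ) t * t')) :=
    (hp'.mul hr').unique ((hγ'.sub (ht'.mul hγ'')).congr_of_eventuallyEq (.of_forall fun u =>
      div_mul_cancel₀ _ (sqrt_one_add_pos ω (treadmill₁ x y u)).ne'))
  have h3 : q' = p' * (ω * η) + p * (ω * η') + deriv (deriv γ) t * t' :=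
    hq'.unique ((hp'.mul (hη'.const_mul ω)).add hγ'')
  rw [h3]
  -- Multiplying `h2` by `r` produces only `r²`, `r r'` and `t r`, all polynomial in `ω`, `η`, `η'`.
  -- The first-order terms in `γ'` cancel, leaving `γ''`, which also occurs in `Q'`.
  linear_combination r * h2 - p * h1 / 2 - p' * hr2 - (deriv (deriv γ) t * t') * htr

end

/-! ### The helicoidal surface: its normal, Cahn–Hoffman field and anisotropic mean curvature. -/

section

variable {γ x y : ℝ → ℝ} {J : Set ℝ} {ω C s : ℝ}

theorem hasDerivAt_rotation_fst {a b : ℝ → ℝ} {a' b' s : ℝ} (ha : HasDerivAt a a' s)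
    (hb : HasDerivAt b b' s) (ω θ : ℝ) :
    HasDerivAt (fun s => a s * Real.cos (ω * θ) + b s * Real.sin (ω * θ))
      (a' * Real.cos (ω * θ) + b' * Real.sin (ω * θ)) s :=
  (ha.mul_const _).add (hb.mul_const _)

theorem hasDerivAt_rotation_snd (a b ω θ : ℝ) :
    HasDerivAt (fun θ => a * Real.cos (ω * θ) + b * Real.sin (ω * θ))
      (ω * (b * Real.cos (ω * θ) - a * Real.sin (ω * θ))) θ := by
  have h : HasDerivAt (fun θ : ℝ => ω * θ) ω θ := by
    simpa using (hasDerivAt_id θ).const_mul ω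
  exact ((h.cos.const_mul a).add (h.sin.const_mul b)).congr_deriv (by ring)

theorem contDiffOn_rotation {a b : ℝ → ℝ} (ha : ContDiffOn ℝ (⊤ : ℕ∞) a J)
    (hb : ContDiffOn ℝ (⊤ : ℕ∞) b J) (ω : ℝ) :
    ContDiffOn ℝ (⊤ : ℕ∞)
      (fun p : ℝ × ℝ => a p.1 * Real.cos (ω * p.2) + b p.1 * Real.sin (ω * p.2))
      (J ×ˢ Set.univ) := by
  have hm : Set.MapsTo Prod.fst (J ×ˢ (Set.univ : Set ℝ)) J := fun q hq => hq.1
  have hc : ContDiff ℝ (⊤ : ℕ∞) fun p : ℝ × ℝ => Real.cos (ω * p.2) := by fun_prop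
  have hsn : ContDiff ℝ (⊤ : ℕ∞) fun p : ℝ × ℝ => Real.sin (ω * p.2) := by fun_prop
  exact ((ha.comp contDiffOn_fst hm).mul hc.contDiffOn).add
    ((hb.comp contDiffOn_fst hm).mul hsn.contDiffOn)

theorem contDiffOn_toEuclidean3 {n : WithTop ℕ∞} {f g h : ℝ × ℝ → ℝ} {U : Set (ℝ × ℝ)}
    (hf : ContDiffOn ℝ n f U) (hg : ContDiffOn ℝ n g U) (hh : ContDiffOn ℝ n h U) :
    ContDiffOn ℝ n (fun p => !₂[f p, g p, h p]) U := by
  rw [contDiffOn_euclidean]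
  intro i
  fin_cases i <;> simpa

theorem contDiffOn_helicoidalSurface (hx : ContDiffOn ℝ (⊤ : ℕ∞) x J)
    (hy : ContDiffOn ℝ (⊤ : ℕ∞) y J) :
    ContDiffOn ℝ (⊤ : ℕ∞) (helicoidalSurface x y ω C) (J ×ˢ Set.univ) := by
  refine contDiffOn_toEuclidean3 (contDiffOn_rotation hx hy ω) ?_ (by fun_prop)
  exact (contDiffOn_rotation hy hx.neg ω).congr fun p _ => by simp; ring

theorem differentiableAt_of_contDiffOn_prod_univ {f : ℝ × ℝ → EuclideanSpace ℝ (Fin 3)}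
    (hJo : IsOpen J) (hf : ContDiffOn ℝ (⊤ : ℕ∞) f (J ×ˢ Set.univ)) {p : ℝ × ℝ}
    (hp : p.1 ∈ J) : DifferentiableAt ℝ f p :=
  (hf.differentiableOn (by simp)).differentiableAt
    ((hJo.prod isOpen_univ).mem_nhds ⟨hp, trivial⟩)

theorem fderiv_helicoidalSurface_fst (hJo : IsOpen J) (hx : ContDiffOn ℝ (⊤ : ℕ∞) x J)
    (hy : ContDiffOn ℝ (⊤ : ℕ∞) y J) {p : ℝ × ℝ} (hp : p.1 ∈ J) :
    fderiv ℝ (helicoidalSurface x y ω C) p (1, 0) =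
      !₂[deriv x p.1 * Real.cos (ω * p.2) + deriv y p.1 * Real.sin (ω * p.2),
        deriv y p.1 * Real.cos (ω * p.2) - deriv x p.1 * Real.sin (ω * p.2), 0] := by
  have hx' := hx.hasDerivAt_of_isOpen hJo hp
  have hy' := hy.hasDerivAt_of_isOpen hJo hp
  refine fderiv_apply_one_zero (differentiableAt_of_contDiffOn_prod_univ hJo
    (contDiffOn_helicoidalSurface hx hy) hp) ?_ ?_ ?_
  · simpa [helicoidalSurface] using hasDerivAt_rotation_fst hx' hy' ω p.2
  · exact (hy'.mul_const (Real.cos (ω * p.2))).sub (hx'.mul_const (Real.sin (ω * p.2)))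
  · simpa [helicoidalSurface] using hasDerivAt_const p.1 (p.2 + C)

theorem fderiv_helicoidalSurface_snd (hJo : IsOpen J) (hx : ContDiffOn ℝ (⊤ : ℕ∞) x J)
    (hy : ContDiffOn ℝ (⊤ : ℕ∞) y J) {p : ℝ × ℝ} (hp : p.1 ∈ J) :
    fderiv ℝ (helicoidalSurface x y ω C) p (0, 1) =
      !₂[ω * (y p.1 * Real.cos (ω * p.2) - x p.1 * Real.sin (ω * p.2)),
        -(ω * (x p.1 * Real.cos (ω * p.2) + y p.1 * Real.sin (ω * p.2))), 1] := by
  refine fderiv_apply_zero_one (differentiableAt_of_contDiffOn_prod_univ hJo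
    (contDiffOn_helicoidalSurface hx hy) hp) ?_ ?_ ?_
  · simpa [helicoidalSurface] using hasDerivAt_rotation_snd (x p.1) (y p.1) ω p.2
  · have h := hasDerivAt_rotation_snd (y p.1) (-x p.1) ω p.2
    simp only [neg_mul, ← sub_eq_add_neg] at h
    simpa [helicoidalSurface] using h.congr_deriv (by ring)
  · simpa [helicoidalSurface] using (hasDerivAt_id p.2).add_const C

theorem surfaceNormal_helicoidalSurface (hJo : IsOpen J) (hx : ContDiffOn ℝ (⊤ : ℕ∞) x J)
    (hy : ContDiffOn ℝ (⊤ : ℕ∞) y J) {p : ℝ × ℝ} (hp : p.1 ∈ J) :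
    surfaceNormal (helicoidalSurface x y ω C) p =
      !₂[deriv y p.1 * Real.cos (ω * p.2) - deriv x p.1 * Real.sin (ω * p.2),
        -(deriv x p.1 * Real.cos (ω * p.2) + deriv y p.1 * Real.sin (ω * p.2)),
        ω * treadmill₁ x y p.1] := by
  rw [surfaceNormal, fderiv_helicoidalSurface_fst hJo hx hy hp,
    fderiv_helicoidalSurface_snd hJo hx hy hp]
  refine euclidean3_ext ?_ ?_ ?_
  · simp [cross3_apply_zero]
  · simp [cross3_apply_one]
  · simp [cross3_apply_two, treadmill₁_eq hJo hx hy hp]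
    linear_combination
      (-ω * (x p.1 * deriv x p.1 + y p.1 * deriv y p.1)) * Real.cos_sq_add_sin_sq (ω * p.2)

theorem norm_surfaceNormal_helicoidalSurface (hJo : IsOpen J)
    (hx : ContDiffOn ℝ (⊤ : ℕ∞) x J) (hy : ContDiffOn ℝ (⊤ : ℕ∞) y J)
    (harc : ∀ s ∈ J, deriv x s ^ 2 + deriv y s ^ 2 = 1) {p : ℝ × ℝ} (hp : p.1 ∈ J) :
    ‖surfaceNormal (helicoidalSurface x y ω C) p‖ =
      Real.sqrt (1 + ω ^ 2 * treadmill₁ x y p.1 ^ 2) := by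
  rw [surfaceNormal_helicoidalSurface hJo hx hy hp, EuclideanSpace.norm_eq]
  congr 1
  simp [Fin.sum_univ_three]
  linear_combination (Real.cos (ω * p.2) ^ 2 + Real.sin (ω * p.2) ^ 2) * harc p.1 hp +
    Real.cos_sq_add_sin_sq (ω * p.2)

theorem surfaceNormal_helicoidalSurface_mem (hJo : IsOpen J)
    (hx : ContDiffOn ℝ (⊤ : ℕ∞) x J) (hy : ContDiffOn ℝ (⊤ : ℕ∞) y J)
    (harc : ∀ s ∈ J, deriv x s ^ 2 + deriv y s ^ 2 = 1) {p : ℝ × ℝ} (hp : p.1 ∈ J) :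
    surfaceNormal (helicoidalSurface x y ω C) p ∈ nonverticalVectors := by
  rw [nonverticalVectors, Set.mem_ofPred_eq, norm_surfaceNormal_helicoidalSurface hJo hx hy harc hp,
    surfaceNormal_helicoidalSurface hJo hx hy hp]
  refine Real.lt_sqrt_of_sq_lt ?_
  simp [mul_pow]

theorem surfaceNormal_helicoidalSurface_ne_zero (hJo : IsOpen J)
    (hx : ContDiffOn ℝ (⊤ : ℕ∞) x J) (hy : ContDiffOn ℝ (⊤ : ℕ∞) y J)
    (harc : ∀ s ∈ J, deriv x s ^ 2 + deriv y s ^ 2 = 1) {p : ℝ × ℝ} (hp : p.1 ∈ J) :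
    surfaceNormal (helicoidalSurface x y ω C) p ≠ 0 :=
  norm_pos_iff.1 (nonverticalVectors_norm_pos
    (surfaceNormal_helicoidalSurface_mem hJo hx hy harc hp))

/-- The Cahn–Hoffman field of a helicoidal surface. -/
noncomputable def helicoidalCahnHoffman (γ x y : ℝ → ℝ) (ω : ℝ) (p : ℝ × ℝ) :
    EuclideanSpace ℝ (Fin 3) :=
  !₂[cahnHoffmanHorizontal γ x y ω p.1 *
      (deriv y p.1 * Real.cos (ω * p.2) - deriv x p.1 * Real.sin (ω * p.2)),
    -(cahnHoffmanHorizontal γ x y ω p.1 *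
      (deriv x p.1 * Real.cos (ω * p.2) + deriv y p.1 * Real.sin (ω * p.2))),
    cahnHoffmanVertical γ x y ω p.1]

theorem contDiffOn_helicoidalCahnHoffman (hγ : ContDiffOn ℝ (⊤ : ℕ∞) γ (Set.Ioo (-1) 1))
    (hJo : IsOpen J) (hx : ContDiffOn ℝ (⊤ : ℕ∞) x J) (hy : ContDiffOn ℝ (⊤ : ℕ∞) y J) :
    ContDiffOn ℝ (⊤ : ℕ∞) (helicoidalCahnHoffman γ x y ω) (J ×ˢ Set.univ) := by
  have hm : Set.MapsTo Prod.fst (J ×ˢ (Set.univ : Set ℝ)) J := fun q hq => hq.1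
  have hx' := hx.deriv_smooth hJo
  have hy' := hy.deriv_smooth hJo
  have hp := (contDiffOn_cahnHoffmanHorizontal (ω := ω) hγ hJo hx hy).comp contDiffOn_fst hm
  refine contDiffOn_toEuclidean3 (hp.mul ?_) (hp.mul (contDiffOn_rotation hx' hy' ω)).neg
    ((contDiffOn_cahnHoffmanVertical hγ hJo hx hy).comp contDiffOn_fst hm)
  exact (contDiffOn_rotation hy' hx'.neg ω).congr fun p _ => by simp; ring

theorem fderiv_homogeneousExtension_helicoidalSurface
    (hγ : ContDiffOn ℝ (⊤ : ℕ∞) γ (Set.Ioo (-1) 1)) (hJo : IsOpen J)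
    (hx : ContDiffOn ℝ (⊤ : ℕ∞) x J) (hy : ContDiffOn ℝ (⊤ : ℕ∞) y J)
    (harc : ∀ s ∈ J, deriv x s ^ 2 + deriv y s ^ 2 = 1) {p : ℝ × ℝ} (hp : p.1 ∈ J)
    (w : EuclideanSpace ℝ (Fin 3)) :
    fderiv ℝ (homogeneousExtension fun ν => γ (ν 2))
        (surfaceNormal (helicoidalSurface x y ω C) p) w =
      inner ℝ (helicoidalCahnHoffman γ x y ω p) w := by
  have hslope : ‖surfaceNormal (helicoidalSurface x y ω C) p‖⁻¹ *
      surfaceNormal (helicoidalSurface x y ω C) p 2 = helicoidalSlope x y ω p.1 := by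
    rw [norm_surfaceNormal_helicoidalSurface hJo hx hy harc hp,
      surfaceNormal_helicoidalSurface hJo hx hy hp, helicoidalSlope, div_eq_inv_mul]
    rfl
  rw [fderiv_homogeneousExtension_axial (hγ.of_le (by exact_mod_cast le_top))
    (surfaceNormal_helicoidalSurface_mem hJo hx hy harc hp), hslope,
    norm_surfaceNormal_helicoidalSurface hJo hx hy harc hp,
    surfaceNormal_helicoidalSurface hJo hx hy hp, ← cahnHoffmanHorizontal]
  simp [euclidean3_inner, helicoidalCahnHoffman, cahnHoffmanVertical]
  ring

/-- The entries are kept in the form `a cos + b sin`, with signs absorbed in `a` and `b`, so that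
the two rotation derivative lemmas apply directly. -/
theorem cross3_fderiv_snd_cahnHoffman (hJo : IsOpen J) (hx : ContDiffOn ℝ (⊤ : ℕ∞) x J)
    (hy : ContDiffOn ℝ (⊤ : ℕ∞) y J) {p : ℝ × ℝ} (hp : p.1 ∈ J) :
    cross3 (fderiv ℝ (helicoidalSurface x y ω C) p (0, 1)) (helicoidalCahnHoffman γ x y ω p) =
      !₂[cahnHoffmanHorizontal γ x y ω p.1 *
            (deriv x p.1 * Real.cos (ω * p.2) + deriv y p.1 * Real.sin (ω * p.2)) -
          ω * cahnHoffmanVertical γ x y ω p.1 *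
            (x p.1 * Real.cos (ω * p.2) + y p.1 * Real.sin (ω * p.2)),
        cahnHoffmanHorizontal γ x y ω p.1 *
            (deriv y p.1 * Real.cos (ω * p.2) + -deriv x p.1 * Real.sin (ω * p.2)) -
          ω * cahnHoffmanVertical γ x y ω p.1 *
            (y p.1 * Real.cos (ω * p.2) + -x p.1 * Real.sin (ω * p.2)),
        ω * (cahnHoffmanHorizontal γ x y ω p.1 * treadmill₂ x y p.1)] := by
  rw [fderiv_helicoidalSurface_snd hJo hx hy hp]
  refine euclidean3_ext ?_ ?_ ?_
  · simp [cross3_apply_zero, helicoidalCahnHoffman]; ring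
  · simp [cross3_apply_one, helicoidalCahnHoffman]; ring
  · simp [cross3_apply_two, helicoidalCahnHoffman, treadmill₂]
    linear_combination ω * cahnHoffmanHorizontal γ x y ω p.1 *
      (x p.1 * deriv y p.1 - y p.1 * deriv x p.1) * Real.cos_sq_add_sin_sq (ω * p.2)

theorem cross3_cahnHoffman_fderiv_fst (hJo : IsOpen J) (hx : ContDiffOn ℝ (⊤ : ℕ∞) x J)
    (hy : ContDiffOn ℝ (⊤ : ℕ∞) y J) (harc : ∀ s ∈ J, deriv x s ^ 2 + deriv y s ^ 2 = 1)
    {p : ℝ × ℝ} (hp : p.1 ∈ J) :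
    cross3 (helicoidalCahnHoffman γ x y ω p) (fderiv ℝ (helicoidalSurface x y ω C) p (1, 0)) =
      !₂[-cahnHoffmanVertical γ x y ω p.1 *
            (deriv y p.1 * Real.cos (ω * p.2) + -deriv x p.1 * Real.sin (ω * p.2)),
        cahnHoffmanVertical γ x y ω p.1 *
            (deriv x p.1 * Real.cos (ω * p.2) + deriv y p.1 * Real.sin (ω * p.2)),
        cahnHoffmanHorizontal γ x y ω p.1] := by
  rw [fderiv_helicoidalSurface_fst hJo hx hy hp]
  refine euclidean3_ext ?_ ?_ ?_
  · simp [cross3_apply_zero, helicoidalCahnHoffman]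
    exact Or.inl (by ring)
  · simp [cross3_apply_one, helicoidalCahnHoffman]
  · simp [cross3_apply_two, helicoidalCahnHoffman]
    linear_combination cahnHoffmanHorizontal γ x y ω p.1 *
      ((Real.cos (ω * p.2) ^ 2 + Real.sin (ω * p.2) ^ 2) * harc p.1 hp +
        Real.cos_sq_add_sin_sq (ω * p.2))

/-- The divergence form of the first variation of a helicoidal surface. -/
theorem divergence_helicoidalCahnHoffman (hγ : ContDiffOn ℝ (⊤ : ℕ∞) γ (Set.Ioo (-1) 1))
    (hJo : IsOpen J) (hx : ContDiffOn ℝ (⊤ : ℕ∞) x J) (hy : ContDiffOn ℝ (⊤ : ℕ∞) y J)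
    (harc : ∀ s ∈ J, deriv x s ^ 2 + deriv y s ^ 2 = 1) {p : ℝ × ℝ} (hp : p.1 ∈ J) :
    fderiv ℝ (fun q => cross3 (fderiv ℝ (helicoidalSurface x y ω C) q (0, 1))
        (helicoidalCahnHoffman γ x y ω q)) p (1, 0) +
      fderiv ℝ (fun q => cross3 (helicoidalCahnHoffman γ x y ω q)
        (fderiv ℝ (helicoidalSurface x y ω C) q (1, 0))) p (0, 1) =
      helicoidalAMC γ x y ω p.1 • surfaceNormal (helicoidalSurface x y ω C) p := by
  have hU : IsOpen (J ×ˢ (Set.univ : Set ℝ)) := hJo.prod isOpen_univ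
  have hX' : ∀ v, ContDiffOn ℝ (⊤ : ℕ∞) (fun p => fderiv ℝ (helicoidalSurface x y ω C) p v)
      (J ×ˢ Set.univ) := fun v =>
    ((contDiffOn_helicoidalSurface hx hy).fderiv_of_isOpen hU (by simp)).clm_apply
      contDiffOn_const
  have hξ := contDiffOn_helicoidalCahnHoffman (ω := ω) hγ hJo hx hy
  have hx1 := hx.hasDerivAt_of_isOpen hJo hp
  have hy1 := hy.hasDerivAt_of_isOpen hJo hp
  have hx2 := (hx.deriv_smooth hJo).hasDerivAt_of_isOpen hJo hp
  have hy2 := (hy.deriv_smooth hJo).hasDerivAt_of_isOpen hJo hp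
  have hP := (contDiffOn_cahnHoffmanHorizontal (ω := ω) hγ hJo hx hy).hasDerivAt_of_isOpen hJo hp
  have hQ := (contDiffOn_cahnHoffmanVertical (ω := ω) hγ hJo hx hy).hasDerivAt_of_isOpen hJo hp
  have heta := hasDerivAt_treadmill₂ hJo hx hy harc hp
  obtain ⟨fx, fy⟩ := frenet_equations hJo hx hy harc hp
  have hnear : ∀ᶠ s in 𝓝 p.1, s ∈ J := hJo.mem_nhds hp
  have e1 := fderiv_apply_one_zero (differentiableAt_of_contDiffOn_prod_univ hJo
    ((hX' (0, 1)).cross3 hξ) hp)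
    (((hP.mul (hasDerivAt_rotation_fst hx2 hy2 ω p.2)).sub
      ((hQ.const_mul ω).mul (hasDerivAt_rotation_fst hx1 hy1 ω p.2))).congr_of_eventuallyEq
      (hnear.mono fun s hs => by
        simp only [cross3_fderiv_snd_cahnHoffman (p := (s, p.2)) hJo hx hy hs]; rfl))
    (((hP.mul (hasDerivAt_rotation_fst hy2 hx2.neg ω p.2)).sub
      ((hQ.const_mul ω).mul (hasDerivAt_rotation_fst hy1 hx1.neg ω p.2))).congr_of_eventuallyEq
      (hnear.mono fun s hs => by
        simp only [cross3_fderiv_snd_cahnHoffman (p := (s, p.2)) hJo hx hy hs]; rfl))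
    (((hP.mul heta).const_mul ω).congr_of_eventuallyEq
      (hnear.mono fun s hs => by
        simp only [cross3_fderiv_snd_cahnHoffman (p := (s, p.2)) hJo hx hy hs]; rfl))
  have e2 := fderiv_apply_zero_one (differentiableAt_of_contDiffOn_prod_univ hJo
    (hξ.cross3 (hX' (1, 0))) hp)
    (((hasDerivAt_rotation_snd (deriv y p.1) (-deriv x p.1) ω p.2).const_mul
      (-cahnHoffmanVertical γ x y ω p.1)).congr_of_eventuallyEq
      (.of_forall fun θ => by
        simp only [cross3_cahnHoffman_fderiv_fst (p := (p.1, θ)) hJo hx hy harc hp]; rfl))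
    (((hasDerivAt_rotation_snd (deriv x p.1) (deriv y p.1) ω p.2).const_mul
      (cahnHoffmanVertical γ x y ω p.1)).congr_of_eventuallyEq
      (.of_forall fun θ => by
        simp only [cross3_cahnHoffman_fderiv_fst (p := (p.1, θ)) hJo hx hy harc hp]; rfl))
    ((hasDerivAt_const p.2 (cahnHoffmanHorizontal γ x y ω p.1)).congr_of_eventuallyEq
      (.of_forall fun θ => by
        simp only [cross3_cahnHoffman_fderiv_fst (p := (p.1, θ)) hJo hx hy harc hp]; rfl))
  -- The terms with undifferentiated `Q` cancel between the two divergences. After `P' = -ω Q' η₁`,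
  -- the horizontal `Q'` part is `-ω Q' (η₁ T + (x + i y))`, up to rotation, and this is normal
  -- because `x + i y = -(η₁ + i η₂) T`; the unit length of `T` enters only here.
  rw [e1, e2, surfaceNormal_helicoidalSurface hJo hx hy hp,
    deriv_cahnHoffmanHorizontal hγ hJo hx hy hp, fx, fy, helicoidalAMC]
  have ha := harc p.1 hp
  set c := Real.cos (ω * p.2)
  set sn := Real.sin (ω * p.2)
  set κ := arcCurvature x y p.1
  set P := cahnHoffmanHorizontal γ x y ω p.1
  set Q := cahnHoffmanVertical γ x y ω p.1
  set Q' := deriv (cahnHoffmanVertical γ x y ω) p.1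
  refine euclidean3_ext ?_ ?_ ?_
  · simp [treadmill₁_eq hJo hx hy hp, treadmill₂]
    linear_combination ω * Q' * (x p.1 * c + y p.1 * sn) * ha
  · simp [treadmill₁_eq hJo hx hy hp, treadmill₂]
    linear_combination ω * Q' * (y p.1 * c - x p.1 * sn) * ha
  · simp
    ring

/-- The anisotropic mean curvature of a helicoidal surface. -/
theorem hasAnisotropicMeanCurvature_helicoidalSurface
    (hγ : ContDiffOn ℝ (⊤ : ℕ∞) γ (Set.Ioo (-1) 1)) (hJo : IsOpen J)
    (hx : ContDiffOn ℝ (⊤ : ℕ∞) x J) (hy : ContDiffOn ℝ (⊤ : ℕ∞) y J)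
    (harc : ∀ s ∈ J, deriv x s ^ 2 + deriv y s ^ 2 = 1) :
    HasAnisotropicMeanCurvature (fun ν => γ (ν 2)) (J ×ˢ Set.univ) (helicoidalSurface x y ω C)
      fun p => helicoidalAMC γ x y ω p.1 :=
  hasAnisotropicMeanCurvature_of_divergence isOpen_nonverticalVectors
    (contDiffOn_homogeneousExtension_axial (hγ.of_le (by exact_mod_cast le_top)))
    (hJo.prod isOpen_univ)
    (contDiffOn_infty.1 (contDiffOn_helicoidalSurface hx hy) 2)
    (fun _ hp => surfaceNormal_helicoidalSurface_mem hJo hx hy harc hp.1)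
    (fun _ hp => surfaceNormal_helicoidalSurface_ne_zero hJo hx hy harc hp.1)
    ((contDiffOn_helicoidalCahnHoffman hγ hJo hx hy).of_le (by exact_mod_cast le_top))
    (fun _ hp w => fderiv_homogeneousExtension_helicoidalSurface hγ hJo hx hy harc hp.1 w)
    (fun _ hp => divergence_helicoidalCahnHoffman hγ hJo hx hy harc hp.1)

/-- The explicit `H` satisfies the first variation formula, so uniqueness among continuous functions
turns the variational condition into a pointwise one. -/
theorem helicoidalHasConstantAMC_iff (hγ : ContDiffOn ℝ (⊤ : ℕ∞) γ (Set.Ioo (-1) 1))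
    (hJo : IsOpen J) (hx : ContDiffOn ℝ (⊤ : ℕ∞) x J) (hy : ContDiffOn ℝ (⊤ : ℕ∞) y J)
    (harc : ∀ s ∈ J, deriv x s ^ 2 + deriv y s ^ 2 = 1) (Λ : ℝ) :
    HelicoidalHasConstantAMC γ J x y ω C Λ ↔ ∀ s ∈ J, helicoidalAMC γ x y ω s = Λ := by
  have h := hasAnisotropicMeanCurvature_helicoidalSurface (ω := ω) (C := C) hγ hJo hx hy harc
  refine ⟨fun hΛ s hs => ?_, fun hΛ => h.congr fun p hp => hΛ p.1 hp.1⟩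
  have hc : ContinuousOn (fun p : ℝ × ℝ => helicoidalAMC γ x y ω p.1) (J ×ˢ Set.univ) :=
    (contDiffOn_helicoidalAMC hγ hJo hx hy).continuousOn.comp continuousOn_fst fun q hq => hq.1
  have hX : ContDiffOn ℝ 1 (helicoidalSurface x y ω C) (J ×ˢ Set.univ) :=
    (contDiffOn_helicoidalSurface hx hy).of_le (by exact_mod_cast le_top)
  have heq := h.eqOn (hJo.prod isOpen_univ) hX
    (fun _ hp => surfaceNormal_helicoidalSurface_ne_zero hJo hx hy harc hp.1) hc
    continuousOn_const hΛ
  have hmem : (s, (0 : ℝ)) ∈ J ×ˢ (Set.univ : Set ℝ) := ⟨hs, trivial⟩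
  have hval := heq hmem
  exact hval

end

/-! ### The first integral, cancellation of `η₁`, and the unit tangent. -/

section

variable {γ x y : ℝ → ℝ} {J : Set ℝ} {ω C s : ℝ}

theorem twizzlerEquation_iff {Λ A : ℝ} :
    TwizzlerEquation γ J x y ω Λ A ↔ ∀ s ∈ J,
      Λ * (treadmill₁ x y s ^ 2 + treadmill₂ x y s ^ 2) +
        2 * treadmill₂ x y s * cahnHoffmanHorizontal γ x y ω s + A = 0 := by
  refine forall₂_congr fun s _ => ?_
  rw [wulffMu₂, ← helicoidalSlope, one_div_mul_eq_div, div_div_eq_mul_div, mul_div_assoc,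
    ← cahnHoffmanHorizontal]

theorem exists_add_eq_zero_iff_deriv {f f' : ℝ → ℝ} (hJo : IsOpen J) (hJc : J.OrdConnected)
    (hf : ∀ s ∈ J, HasDerivAt f (f' s) s) :
    (∃ A : ℝ, ∀ s ∈ J, f s + A = 0) ↔ ∀ s ∈ J, f' s = 0 := by
  constructor
  · rintro ⟨A, hA⟩ s hs
    exact ((hf s hs).add_const A).unique ((hasDerivAt_const s (0 : ℝ)).congr_of_eventuallyEq
      (Filter.eventuallyEq_of_mem (hJo.mem_nhds hs) hA))
  · intro h
    obtain rfl | ⟨s₀, hs₀⟩ := J.eq_empty_or_nonempty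
    · exact ⟨0, fun s hs => hs.elim⟩
    · refine ⟨-f s₀, fun s hs => ?_⟩
      rw [hJo.is_const_of_deriv_eq_zero hJc.isPreconnected
        (fun t ht => (hf t ht).differentiableAt.differentiableWithinAt)
        (fun t ht => (hf t ht).deriv.trans (h t ht)) hs hs₀, add_neg_cancel]

/-- The `Λ` part has derivative `-2 Λ η₁`, since `η₁² + η₂² = x² + y²`; the other part has
derivative `2 (η₂' P + η₂ P')`, and both `η₂' = -κ η₁` and `P' = -ω Q' η₁` contain `η₁`, leaving `2
η₁ H`. -/
theorem hasDerivAt_twizzler (hγ : ContDiffOn ℝ (⊤ : ℕ∞) γ (Set.Ioo (-1) 1)) (hJo : IsOpen J)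
    (hx : ContDiffOn ℝ (⊤ : ℕ∞) x J) (hy : ContDiffOn ℝ (⊤ : ℕ∞) y J)
    (harc : ∀ s ∈ J, deriv x s ^ 2 + deriv y s ^ 2 = 1) (Λ : ℝ) (hs : s ∈ J) :
    HasDerivAt (fun s => Λ * (treadmill₁ x y s ^ 2 + treadmill₂ x y s ^ 2) +
        2 * treadmill₂ x y s * cahnHoffmanHorizontal γ x y ω s)
      (-2 * (treadmill₁ x y s * (Λ - helicoidalAMC γ x y ω s))) s := by
  have h1 := hasDerivAt_treadmill₁ hJo hx hy harc hs
  have h2 := hasDerivAt_treadmill₂ hJo hx hy harc hs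
  have hP := (contDiffOn_cahnHoffmanHorizontal (ω := ω) hγ hJo hx hy).hasDerivAt_of_isOpen hJo hs
  rw [deriv_cahnHoffmanHorizontal hγ hJo hx hy hs] at hP
  refine ((((h1.pow 2).add (h2.pow 2)).const_mul Λ).add
    ((h2.const_mul 2).mul hP)).congr_deriv ?_
  simp only [Nat.cast_ofNat, Nat.add_one_sub_one, pow_one, helicoidalAMC]
  ring

theorem exists_twizzlerEquation_iff (hγ : ContDiffOn ℝ (⊤ : ℕ∞) γ (Set.Ioo (-1) 1))
    (hJo : IsOpen J) (hJc : J.OrdConnected) (hx : ContDiffOn ℝ (⊤ : ℕ∞) x J)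
    (hy : ContDiffOn ℝ (⊤ : ℕ∞) y J) (harc : ∀ s ∈ J, deriv x s ^ 2 + deriv y s ^ 2 = 1)
    (Λ : ℝ) :
    (∃ A : ℝ, TwizzlerEquation γ J x y ω Λ A) ↔
      ∀ s ∈ J, treadmill₁ x y s * (Λ - helicoidalAMC γ x y ω s) = 0 := by
  simp_rw [twizzlerEquation_iff]
  rw [exists_add_eq_zero_iff_deriv hJo hJc
    fun s hs => hasDerivAt_twizzler hγ hJo hx hy harc Λ hs]
  simp

theorem exists_sq_add_sq_eq_iff (hJo : IsOpen J) (hJc : J.OrdConnected)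
    (hx : ContDiffOn ℝ (⊤ : ℕ∞) x J) (hy : ContDiffOn ℝ (⊤ : ℕ∞) y J) :
    (∃ R : ℝ, ∀ s ∈ J, x s ^ 2 + y s ^ 2 = R ^ 2) ↔ ∀ s ∈ J, treadmill₁ x y s = 0 := by
  have hd : ∀ s ∈ J, HasDerivAt (fun s => x s ^ 2 + y s ^ 2) (-2 * treadmill₁ x y s) s := by
    intro s hs
    have h := ((hx.pow 2).add (hy.pow 2)).hasDerivAt_of_isOpen hJo hs
    refine h.congr_deriv ?_
    rw [treadmill₁]
    ring
  have key := exists_add_eq_zero_iff_deriv hJo hJc hd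
  simp only [neg_mul, neg_eq_zero, mul_eq_zero, OfNat.ofNat_ne_zero, false_or] at key
  rw [← key]
  constructor
  · rintro ⟨R, hR⟩
    exact ⟨-R ^ 2, fun s hs => by rw [hR s hs]; ring⟩
  · rintro ⟨A, hA⟩
    -- The constant value of `x² + y²` is `-A`, hence nonnegative as soon as `J` has a point.
    refine ⟨Real.sqrt (-A), fun s hs => ?_⟩
    have h := hA s hs
    rw [Real.sq_sqrt (by nlinarith [sq_nonneg (x s), sq_nonneg (y s)])]
    linarith

/-- On arcs of circles about the origin the helicoidal surface is a piece of a circular cylinder. -/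
theorem helicoidalAMC_of_treadmill₁_eq_zero (hJo : IsOpen J) (hx : ContDiffOn ℝ (⊤ : ℕ∞) x J)
    (hy : ContDiffOn ℝ (⊤ : ℕ∞) y J) (harc : ∀ s ∈ J, deriv x s ^ 2 + deriv y s ^ 2 = 1)
    (hs : s ∈ J) (h0 : ∀ᶠ t in 𝓝 s, treadmill₁ x y t = 0) :
    treadmill₂ x y s ≠ 0 ∧ helicoidalAMC γ x y ω s = -γ 0 / treadmill₂ x y s := by
  -- If `η₁` vanishes near `s`, so does `η₁' = -1 + κ η₂`.
  have hκ : arcCurvature x y s * treadmill₂ x y s = 1 := by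
    have h := (hasDerivAt_treadmill₁ hJo hx hy harc hs).unique
      ((hasDerivAt_const s (0 : ℝ)).congr_of_eventuallyEq h0)
    linarith
  have hη : treadmill₂ x y s ≠ 0 := right_ne_zero_of_mul_eq_one hκ
  have hP : cahnHoffmanHorizontal γ x y ω s = γ 0 := by
    simp [cahnHoffmanHorizontal, helicoidalSlope, h0.self_of_nhds]
  have hQ : deriv (cahnHoffmanVertical γ x y ω) s = 0 := by
    refine ((hasDerivAt_const s (deriv γ 0)).congr_of_eventuallyEq
      (h0.mono fun t ht => ?_)).deriv
    simp [cahnHoffmanVertical, helicoidalSlope, ht]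
  refine ⟨hη, ?_⟩
  rw [helicoidalAMC, hP, hQ, eq_div_iff hη]
  linear_combination (-γ 0) * hκ

theorem deriv_helicoidalAMC_of_treadmill₁_eq_zero (hJo : IsOpen J)
    (hx : ContDiffOn ℝ (⊤ : ℕ∞) x J) (hy : ContDiffOn ℝ (⊤ : ℕ∞) y J)
    (harc : ∀ s ∈ J, deriv x s ^ 2 + deriv y s ^ 2 = 1) (hs : s ∈ J)
    (h0 : ∀ᶠ t in 𝓝 s, treadmill₁ x y t = 0) :
    HasDerivAt (helicoidalAMC γ x y ω) 0 s := by
  have hη := (helicoidalAMC_of_treadmill₁_eq_zero (γ := γ) (ω := ω) hJo hx hy harc hs h0).1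
  have hd : HasDerivAt (fun t => -γ 0 / treadmill₂ x y t) 0 s := by
    have h := (hasDerivAt_const s (-γ 0)).div (hasDerivAt_treadmill₂ hJo hx hy harc hs) hη
    exact h.congr_deriv (by simp [h0.self_of_nhds])
  refine hd.congr_of_eventuallyEq ?_
  filter_upwards [h0.eventually_nhds, hJo.mem_nhds hs] with t ht htJ
  exact (helicoidalAMC_of_treadmill₁_eq_zero hJo hx hy harc htJ ht).2

/-- If the differentiated twizzler equation holds along a curve which is not an arc of a circle about
the origin, then the factor `η₁` can be cancelled, even on subarcs where it vanishes. -/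
theorem helicoidalAMC_eq_of_mul_eq_zero (hγ : ContDiffOn ℝ (⊤ : ℕ∞) γ (Set.Ioo (-1) 1))
    (hJo : IsOpen J) (hJc : J.OrdConnected) (hx : ContDiffOn ℝ (⊤ : ℕ∞) x J)
    (hy : ContDiffOn ℝ (⊤ : ℕ∞) y J) (harc : ∀ s ∈ J, deriv x s ^ 2 + deriv y s ^ 2 = 1)
    {Λ : ℝ} (h : ∀ s ∈ J, treadmill₁ x y s * (Λ - helicoidalAMC γ x y ω s) = 0)
    (hne : ¬ ∀ s ∈ J, treadmill₁ x y s = 0) :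
    ∀ s ∈ J, helicoidalAMC γ x y ω s = Λ := by
  have hH := contDiffOn_helicoidalAMC (ω := ω) hγ hJo hx hy
  -- Squaring treats all points alike: the derivative `-2 (Λ - H) H'` vanishes where `H = Λ`, and
  -- elsewhere `η₁` is zero in a neighbourhood, so `H' = 0`. The square is therefore constant on
  -- `J`, and it is zero at a point with `η₁ ≠ 0`.
  have hd : ∀ s ∈ J, HasDerivAt (fun s => (Λ - helicoidalAMC γ x y ω s) ^ 2) 0 s := by
    intro s hs
    have hHs := hH.hasDerivAt_of_isOpen hJo hs
    have hsq := (hHs.const_sub Λ).pow 2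
    by_cases hE : Λ - helicoidalAMC γ x y ω s = 0
    · exact hsq.congr_deriv (by simp [hE])
    · have hz : ∀ᶠ t in 𝓝 s, treadmill₁ x y t = 0 := by
        filter_upwards [(hHs.continuousAt.const_sub Λ).eventually_ne hE, hJo.mem_nhds hs]
          with t ht htJ
        exact (mul_eq_zero.1 (h t htJ)).resolve_right ht
      have h0 := hHs.unique (deriv_helicoidalAMC_of_treadmill₁_eq_zero hJo hx hy harc hs hz)
      exact hsq.congr_deriv (by simp [h0])
  push Not at hne
  obtain ⟨s₁, hs₁, hne⟩ := hne
  intro s hs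
  have hconst := hJo.is_const_of_deriv_eq_zero hJc.isPreconnected
    (fun t ht => (hd t ht).differentiableAt.differentiableWithinAt)
    (fun t ht => (hd t ht).deriv) hs hs₁
  rw [(mul_eq_zero.1 (h s₁ hs₁)).resolve_left hne, zero_pow two_ne_zero] at hconst
  linarith [pow_eq_zero_iff two_ne_zero |>.1 hconst]

/-- The unit tangent of a plane curve is obtained by integrating its curvature. -/
theorem tangent_eq_exp_integral_arcCurvature (hJo : IsOpen J) (hJc : J.OrdConnected)
    (hx : ContDiffOn ℝ (⊤ : ℕ∞) x J) (hy : ContDiffOn ℝ (⊤ : ℕ∞) y J)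
    (harc : ∀ s ∈ J, deriv x s ^ 2 + deriv y s ^ 2 = 1) {s₀ : ℝ} (hs₀ : s₀ ∈ J) (hs : s ∈ J) :
    ((deriv x s : ℝ) : ℂ) + Complex.I * ((deriv y s : ℝ) : ℂ) =
      (((deriv x s₀ : ℝ) : ℂ) + Complex.I * ((deriv y s₀ : ℝ) : ℂ)) *
        Complex.exp (Complex.I * ((∫ t in s₀..s, arcCurvature x y t : ℝ) : ℂ)) := by
  have hκ : ContinuousOn (arcCurvature x y) J := (contDiffOn_arcCurvature hJo hx hy).continuousOn
  have hΘ : ∀ t ∈ J, HasDerivAt (fun t => ∫ u in s₀..t, arcCurvature x y u)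
      (arcCurvature x y t) t := fun t ht =>
    intervalIntegral.integral_hasDerivAt_right
      ((hκ.mono (hJc.uIcc_subset hs₀ ht)).intervalIntegrable)
      (hκ.stronglyMeasurableAtFilter hJo t ht) (hκ.continuousAt (hJo.mem_nhds ht))
  -- Integrating factor: `T' = i κ T` makes `T exp(-i ∫ κ)` constant.
  have hW : ∀ t ∈ J, HasDerivAt (fun t =>
      (((deriv x t : ℝ) : ℂ) + Complex.I * ((deriv y t : ℝ) : ℂ)) *
        Complex.exp (-(Complex.I * ((∫ u in s₀..t, arcCurvature x y u : ℝ) : ℂ)))) 0 t := by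
    intro t ht
    obtain ⟨fx, fy⟩ := frenet_equations hJo hx hy harc ht
    have hx2 := (fx ▸ (hx.deriv_smooth hJo).hasDerivAt_of_isOpen hJo ht).ofReal_comp
    have hy2 := (fy ▸ (hy.deriv_smooth hJo).hasDerivAt_of_isOpen hJo ht).ofReal_comp
    refine ((hx2.add (hy2.const_mul Complex.I)).mul
      ((((hΘ t ht).ofReal_comp).const_mul Complex.I).neg.cexp)).congr_deriv ?_
    simp only [Pi.add_apply, Pi.neg_apply]
    push_cast
    linear_combination (-(arcCurvature x y t : ℂ) * ((deriv y t : ℝ) : ℂ) *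
      Complex.exp (-(Complex.I * ((∫ u in s₀..t, arcCurvature x y u : ℝ) : ℂ)))) *
        Complex.I_sq
  have hconst := hJo.is_const_of_deriv_eq_zero hJc.isPreconnected
    (fun t ht => (hW t ht).differentiableAt.differentiableWithinAt)
    (fun t ht => (hW t ht).deriv) hs hs₀
  simp only [intervalIntegral.integral_same, Complex.ofReal_zero, mul_zero, neg_zero,
    Complex.exp_zero, mul_one] at hconst
  rw [← hconst, mul_assoc, ← Complex.exp_add, neg_add_cancel, Complex.exp_zero, mul_one]

end

/-! ### The theorem assembled. -/

theorem theorem3p1 (γ : ℝ → ℝ) (hγ : ContDiffOn ℝ (⊤ : ℕ∞) γ (Set.Icc (-1) 1))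
    (hμ : ∀ t ∈ Set.Ioo (-1 : ℝ) 1, γ t - t * deriv γ t ≠ 0)
    (J : Set ℝ) (hJo : IsOpen J) (hJc : J.OrdConnected)
    (x y : ℝ → ℝ) (hx : ContDiffOn ℝ (⊤ : ℕ∞) x J) (hy : ContDiffOn ℝ (⊤ : ℕ∞) y J)
    (harc : ∀ s ∈ J, deriv x s ^ 2 + deriv y s ^ 2 = 1) (ω C : ℝ) :
    -- a surface of constant anisotropic mean curvature `Λ` satisfies the equation with this `Λ`
    (∀ Λ : ℝ, HelicoidalHasConstantAMC γ J x y ω C Λ → ∃ A : ℝ, TwizzlerEquation γ J x y ω Λ A) ∧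
    -- the anisotropic mean curvature is constant if and only if the equation holds
    ((∃ Λ : ℝ, HelicoidalHasConstantAMC γ J x y ω C Λ) ↔
      ∃ Λ A : ℝ, TwizzlerEquation γ J x y ω Λ A) ∧
    -- with the same `Λ`, unless the surface lies on a circular cylinder about the axis
    ((¬ ∃ R : ℝ, ∀ s ∈ J, x s ^ 2 + y s ^ 2 = R ^ 2) →
      ∀ Λ : ℝ, HelicoidalHasConstantAMC γ J x y ω C Λ ↔
        ∃ A : ℝ, TwizzlerEquation γ J x y ω Λ A) ∧
    -- the value of `Λ` on such a cylinder
    ((∃ R : ℝ, ∀ s ∈ J, x s ^ 2 + y s ^ 2 = R ^ 2) →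
      ∀ Λ : ℝ, HelicoidalHasConstantAMC γ J x y ω C Λ ↔
        ∀ s ∈ J, Λ = -1 / (treadmill₂ x y s * wulffMu₂ γ 0)) ∧
    -- recovery of the generating curve from its treadmill sled by a quadrature
    (∀ s₀ ∈ J, ∀ s ∈ J, (∀ t ∈ Set.uIcc s₀ s, treadmill₁ x y t ≠ 0) →
      (x s : ℂ) + Complex.I * (y s : ℂ) =
        -((treadmill₁ x y s : ℂ) + Complex.I * (treadmill₂ x y s : ℂ)) *
          ((((deriv x s₀ : ℝ) : ℂ) + Complex.I * ((deriv y s₀ : ℝ) : ℂ)) *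
            Complex.exp (-Complex.I *
              ((∫ t in s₀..s, deriv (treadmill₂ x y) t / treadmill₁ x y t : ℝ) : ℂ)))) := by
  have hγ' : ContDiffOn ℝ (⊤ : ℕ∞) γ (Set.Ioo (-1) 1) := hγ.mono Set.Ioo_subset_Icc_self
  have hamc : ∀ Λ : ℝ, HelicoidalHasConstantAMC γ J x y ω C Λ ↔
      ∀ s ∈ J, helicoidalAMC γ x y ω s = Λ :=
    helicoidalHasConstantAMC_iff hγ' hJo hx hy harc
  have htw : ∀ Λ : ℝ, (∃ A : ℝ, TwizzlerEquation γ J x y ω Λ A) ↔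
      ∀ s ∈ J, treadmill₁ x y s * (Λ - helicoidalAMC γ x y ω s) = 0 :=
    exists_twizzlerEquation_iff hγ' hJo hJc hx hy harc
  have hcyl := exists_sq_add_sq_eq_iff hJo hJc hx hy
  have hnear : (∀ s ∈ J, treadmill₁ x y s = 0) → ∀ s ∈ J, ∀ᶠ t in 𝓝 s, treadmill₁ x y t = 0 :=
    fun h s hs => Filter.mem_of_superset (hJo.mem_nhds hs) h
  have hnec : ∀ Λ : ℝ, HelicoidalHasConstantAMC γ J x y ω C Λ →
      ∃ A : ℝ, TwizzlerEquation γ J x y ω Λ A := fun Λ h =>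
    (htw Λ).2 fun s hs => by rw [(hamc Λ).1 h s hs, sub_self, mul_zero]
  have hnoncyl : (¬ ∃ R : ℝ, ∀ s ∈ J, x s ^ 2 + y s ^ 2 = R ^ 2) →
      ∀ Λ : ℝ, HelicoidalHasConstantAMC γ J x y ω C Λ ↔
        ∃ A : ℝ, TwizzlerEquation γ J x y ω Λ A := fun hR Λ =>
    ⟨hnec Λ, fun h => (hamc Λ).2 (helicoidalAMC_eq_of_mul_eq_zero hγ' hJo hJc hx hy harc
      ((htw Λ).1 h) (mt hcyl.2 hR))⟩
  refine ⟨hnec, ⟨fun ⟨Λ, h⟩ => ⟨Λ, hnec Λ h⟩, fun ⟨Λ, h⟩ => ?_⟩, hnoncyl, fun hR Λ => ?_,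
    fun s₀ hs₀ s hs hη => ?_⟩
  · by_cases hR : ∃ R : ℝ, ∀ s ∈ J, x s ^ 2 + y s ^ 2 = R ^ 2
    · have hd : ∀ s ∈ J, HasDerivAt (helicoidalAMC γ x y ω) 0 s := fun s hs =>
        deriv_helicoidalAMC_of_treadmill₁_eq_zero hJo hx hy harc hs (hnear (hcyl.1 hR) s hs)
      obtain ⟨A, hA⟩ := (exists_add_eq_zero_iff_deriv hJo hJc hd).2 fun _ _ => rfl
      -- On a cylinder the `Λ` of the equation is discarded, as the equation holds there for every
      -- `Λ`; the curvature is the constant value `-A` of `H`.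
      exact ⟨-A, (hamc _).2 fun s hs => eq_neg_of_add_eq_zero_left (hA s hs)⟩
    · exact ⟨Λ, (hnoncyl hR Λ).2 h⟩
  · rw [hamc]
    refine forall₂_congr fun s hs => ?_
    rw [(helicoidalAMC_of_treadmill₁_eq_zero hJo hx hy harc hs (hnear (hcyl.1 hR) s hs)).2,
      wulffMu₂, zero_mul, sub_zero, mul_one_div, div_div_eq_mul_div, neg_one_mul, eq_comm]
  · have hint : (∫ t in s₀..s, deriv (treadmill₂ x y) t / treadmill₁ x y t) =
        -∫ t in s₀..s, arcCurvature x y t := by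
      rw [← intervalIntegral.integral_neg]
      refine intervalIntegral.integral_congr fun t ht => ?_
      simp only [(hasDerivAt_treadmill₂ hJo hx hy harc (hJc.uIcc_subset hs₀ hs ht)).deriv]
      rw [neg_div, mul_div_cancel_right₀ _ (hη t ht)]
    rw [hint, Complex.ofReal_neg, neg_mul_neg,
      ← tangent_eq_exp_integral_arcCurvature hJo hJc hx hy harc hs₀ hs,
      treadmill₁_eq hJo hx hy hs, treadmill₂]
    have ha := harc s hs
    -- What remains is `x + i y = (x + i y) T̄ T`, which follows from `|T| = 1`.
    apply Complex.ext
    · simp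
      linear_combination (-x s) * ha
    · simp
      linear_combination (-y s) * ha
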